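/- Let $K$ be a field of characteristic $0$, and let $X'\subset\mathbf P^N_K$ be a closed integral subscheme of dimension $2$. Let $X\subset X'$ be an open subscheme that is smooth over $K$, put $\partial X=X'\setminus X$, and let $P$ be a closed point of $X'$ lying in $\partial X$. Let $C'\subset X'$ be a closed integral subscheme of dimension $1$ (a curve) passing through $P$ with $C'\not\subset\partial X$, and let $\eta_{C'}$ be its generic point (it lies in $X$, so it is a simple point of $X'$, and $X$ is dense in $X'$). Then there is a finite $K$-morphism $g:X'\to\mathbf P^2_K$ such that: (0) $g$ is the restriction to $X'$ of a linear projection $\mathbf P^N_K\dashrightarrow\mathbf P^2_K$ whose centre does not meet $X'$, i.e. $g$ is given by three linearly independent linear forms $\ell_0,\ell_1,\ell_2$ over $K$ without common zero on $X'$; (1) the branch locus $B\subset\mathbf P^2_K$ of $g$, i.e. the image under $g$ of the set of points of $X'$ at which $g$ is not étale, does not contain $g(\eta_{C'})$; (2) for every irreducible component $W$ of $\partial X$ of dimension $1$ with $P\notin W$, one has $g(P)\notin g(W)$. -/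

import Mathlib

open AlgebraicGeometry CategoryTheory

universe u

noncomputable section

namespace ProjectiveVariety

/-- The standard grading, by total degree, on `K[x₀, …, x_N]`. -/
abbrev grading (K : Type u) [Field K] (N : ℕ) :
    ℕ → Submodule K (MvPolynomial (Fin (N + 1)) K) :=
  MvPolynomial.homogeneousSubmodule (Fin (N + 1)) K

instance gradedRing (K : Type u) [Field K] (N : ℕ) : GradedRing (grading K N) :=
  MvPolynomial.gradedAlgebra

/-- Projective `N`-space over the field `K`, as the scheme `Proj K[x₀, …, x_N]`. -/
abbrev projSpace (K : Type u) [Field K] (N : ℕ) : Scheme.{u} :=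
  Proj (grading K N)

/-- The structure morphism of projective `N`-space over `K`. -/
def projSpaceStr (K : Type u) [Field K] (N : ℕ) :
    projSpace K N ⟶ Spec (CommRingCat.of K) :=
  Proj.toSpecZero (grading K N) ≫
    Spec.map (CommRingCat.ofHom (algebraMap K (grading K N 0)))

/-- The morphism `f` is étale at the point `x`: it is étale on an open neighbourhood of `x`. -/
def IsEtaleAt {X Y : Scheme.{u}} (f : X ⟶ Y) (x : X) : Prop :=
  ∃ U : X.Opens, x ∈ U ∧ Etale (U.ι ≫ f)

/-- The branch locus of `f : X ⟶ Y`: the image in `Y` of the set of points of `X` at which `f`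
is not étale. -/
def branchLocus {X Y : Scheme.{u}} (f : X ⟶ Y) : Set Y :=
  f '' {x | ¬ IsEtaleAt f x}

/-- Let `i : X ⟶ ℙᴺ` and `g : X ⟶ ℙᴹ`. Then `g` is the restriction to `X` of a linear projection
`ℙᴺ ⇢ ℙᴹ` whose centre does not meet `X`. That is, there are linearly independent linear forms
`ℓ₀, …, ℓ_M` in `x₀, …, x_N`, the images `φ (y_j)` of the coordinates of `ℙᴹ` under a graded
homomorphism `φ` of `K`-algebras, which have no common zero on `X`, and on the open subset
`ℓ_j ≠ 0` of `X` the morphism `g` is the composite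
`X ∩ {ℓ_j ≠ 0} ⟶ Spec K[x₀, …, x_N]_(ℓ_j) ⟶ Spec K[y₀, …, y_M]_(y_j) ⟶ ℙᴹ`,
where the second map is given by `y_k / y_j ↦ ℓ_k / ℓ_j`. -/
def IsLinearProjection {K : Type u} [Field K] {N M : ℕ} {X : Scheme.{u}}
    (i : X ⟶ projSpace K N) (g : X ⟶ projSpace K M) : Prop :=
  ∃ φ : GradedRingHom (grading K M) (grading K N),
    (∀ c : K, φ (MvPolynomial.C c) = MvPolynomial.C c) ∧
    LinearIndependent K (fun j : Fin (M + 1) => φ (MvPolynomial.X j)) ∧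
    (∀ x : X, ∃ j : Fin (M + 1),
      i x ∈ Proj.basicOpen (grading K N) (φ (MvPolynomial.X j))) ∧
    ∀ j : Fin (M + 1),
      (i ⁻¹ᵁ Proj.basicOpen (grading K N) (φ (MvPolynomial.X j))).ι ≫ g =
        i ∣_ Proj.basicOpen (grading K N) (φ (MvPolynomial.X j)) ≫
          Proj.basicOpenToSpec (grading K N) (φ (MvPolynomial.X j)) ≫
          Spec.map (CommRingCat.ofHom
            (HomogeneousLocalization.Away.map φ (MvPolynomial.X j))) ≫
          Proj.awayι (grading K M) (MvPolynomial.X j)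
            (MvPolynomial.isHomogeneous_X K j) one_pos

end ProjectiveVariety

end

/-! Choose ℓ₀ nonzero at P and at the generic points of the components of ∂X, and let B be the
coordinate ring of the affine chart ℓ₀ ≠ 0 of X'. The quotients ℓ/ℓ₀ generate B, and on this chart g
is the map to the affine plane given by a₁ = ℓ₁/ℓ₀ and a₂ = ℓ₂/ℓ₀. Most requirements on ℓ₁ and ℓ₂
hold outside finitely many proper subspaces (`GenericProp`), so over the infinite field K they can
be imposed together. Such are the absence of common zeros (`generic_cover`), which makes g finite,
and the separation of P from the curves W (`generic_separates_curve`). For ℓ₁ there are two more: a₁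
is transcendental on C', and da₁ with one further differential generates the cotangent space at the
generic point η of C' (`generic_transcendental`, `generic_exists_coordinates`).

The branch condition is not of this kind, because g must be étale at every point of the fibre
through η, and that fibre moves with g. Fix a₁ and pass to its generic fibre, an affine curve with
coordinate ring R over k = K(a₁), on which η becomes a closed point c. It suffices to find a₂
unramified along the fibre through c (`exists_unramified_projection`). Unramified and flat over k[X]
means étale, and étaleness descends to B (`exists_etale_projection`).

Look for a₂ = a - t b with t in K. Away from the zeros of some f ≠ 0, db generates the differentials
of the curve; write a' = da/db. A critical point y of a - t b there satisfies a'(y) = t. If y also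
has the image of c, the tangent at y to the curve in the (a, b)-plane passes geometrically through
c. When a'' ≠ 0, this happens for finitely many y only (`exists_eliminant`): otherwise a - α = a'(b
- β) would hold identically over a finite extension, α and β being the coordinates of c, and
differentiating would give a''(b - β) = 0. Each such y excludes one slope. When a'' = 0, the element
a' is algebraic over k and t can only equal a'. So finitely many slopes are bad
(`finite_bad_slopes`). The finitely many zeros of f other than c are separated from c by generic
coordinates, and at c itself the cotangent space is at most one-dimensional, so that a generic
coordinate generates it. -/

open scoped TensorProduct Polynomial

/-! ### Conditions that hold outside finitely many proper subspaces -/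

section Generic

variable {K V : Type*} [Field K] [AddCommGroup V] [Module K V]

/-- A property of vectors is generic if it holds outside finitely many proper subspaces. -/
def GenericProp (K : Type*) {V : Type*} [Field K] [AddCommGroup V] [Module K V]
    (p : V → Prop) : Prop :=
  ∃ S : Finset (Submodule K V), ⊤ ∉ S ∧ ∀ v, (∀ s ∈ S, v ∉ s) → p v

namespace GenericProp

theorem mono {p q : V → Prop} (hp : GenericProp K p) (h : ∀ v, p v → q v) : GenericProp K q :=
  let ⟨S, hS, hv⟩ := hp
  ⟨S, hS, fun v hvS => h v (hv v hvS)⟩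

theorem of_forall {p : V → Prop} (h : ∀ v, p v) : GenericProp K p :=
  ⟨∅, by simp, fun v _ => h v⟩

theorem notMem {s : Submodule K V} (hs : s ≠ ⊤) : GenericProp K (fun v => v ∉ s) :=
  ⟨{s}, by simpa using hs.symm, fun v hv => hv s (by simp)⟩

theorem and {p q : V → Prop} (hp : GenericProp K p) (hq : GenericProp K q) :
    GenericProp K (fun v => p v ∧ q v) := by
  classical
  obtain ⟨S, hS, hpS⟩ := hp
  obtain ⟨T, hT, hqT⟩ := hq
  refine ⟨S ∪ T, by simp [hS, hT], fun v hv => ⟨hpS v fun s hs => hv s ?_, hqT v fun s hs => hv s ?_⟩⟩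
  · exact Finset.mem_union_left _ hs
  · exact Finset.mem_union_right _ hs

theorem forall_mem {ι : Type*} {t : Set ι} (ht : t.Finite) {p : ι → V → Prop}
    (h : ∀ i ∈ t, GenericProp K (p i)) : GenericProp K (fun v => ∀ i ∈ t, p i v) := by
  induction t, ht using Set.Finite.induction_on with
  | empty => exact of_forall (by simp)
  | @insert a s ha hs ih =>
    refine ((h a (by simp)).and (ih fun i hi => h i (by simp [hi]))).mono ?_
    rintro v ⟨h1, h2⟩ i hi
    rcases hi with rfl | hi
    · exact h1
    · exact h2 i hi

theorem exists_of_infinite [Infinite K] {p : V → Prop} (hp : GenericProp K p) : ∃ v, p v := by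
  obtain ⟨S, hS, hpS⟩ := hp
  have := Subspace.biUnion_ne_univ_of_top_notMem hS
  obtain ⟨v, hv⟩ := (Set.ne_univ_iff_exists_notMem _).mp this
  exact ⟨v, hpS v fun s hs hvs => hv (Set.mem_biUnion hs hvs)⟩

/-- A line not contained in a subspace meets it in at most one parameter; lying outside is witnessed
by the origin `a` or by the direction `b`. -/
theorem finite_of_line {S : Finset (Submodule K V)} {a b : V}
    (h : ∀ s ∈ S, a ∉ s ∨ b ∉ s) : {t : K | ∃ s ∈ S, a - t • b ∈ s}.Finite := by
  have : {t : K | ∃ s ∈ S, a - t • b ∈ s} = ⋃ s ∈ S, {t : K | a - t • b ∈ s} := by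
    ext; simp
  rw [this]
  refine S.finite_toSet.biUnion fun s hs => Set.Subsingleton.finite ?_
  intro t ht t' ht'
  by_contra hne
  have hb : b ∈ s := by
    have h1 : (t' - t) • b ∈ s := by
      have := s.sub_mem ht ht'
      convert this using 1
      module
    exact (s.smul_mem_iff (sub_ne_zero.mpr (Ne.symm hne))).mp h1
  have ha : a ∈ s := by
    have := s.add_mem ht (s.smul_mem t hb)
    simpa using this
  rcases h s hs with h | h
  · exact h ha
  · exact h hb

/-- A generic property holds on almost all of a generic line. -/
theorem line_direction {p : V → Prop} (hp : GenericProp K p) :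
    GenericProp K (fun b => ∀ a, {t : K | ¬ p (a - t • b)}.Finite) := by
  obtain ⟨S, hS, hpS⟩ := hp
  refine ⟨S, hS, fun b hb a => (finite_of_line (S := S) (a := a) (b := b)
    fun s hs => Or.inr (hb s hs)).subset fun t ht => ?_⟩
  by_contra hcon
  exact ht (hpS _ fun s hs hmem => hcon ⟨s, hs, hmem⟩)

/-- Counterpart of `line_direction` for conditions that become known only after the direction of the
pencil has been fixed. -/
theorem line_origin {p : V → Prop} (hp : GenericProp K p) :
    GenericProp K (fun a => ∀ b, {t : K | ¬ p (a - t • b)}.Finite) := by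
  obtain ⟨S, hS, hpS⟩ := hp
  refine ⟨S, hS, fun a ha b => (finite_of_line (S := S) (a := a) (b := b)
    fun s hs => Or.inl (ha s hs)).subset fun t ht => ?_⟩
  by_contra hcon
  exact ht (hpS _ fun s hs hmem => hcon ⟨s, hs, hmem⟩)

end GenericProp

end Generic

/-! ### Separating points by a coordinate -/

section SameImage

variable (k : Type*) {R : Type*} [CommRing k] [CommRing R] [Algebra k R]

/-- The points `p` and `q` of `Spec R` have the same image under `a : Spec R → 𝔸¹`. -/
def SameImage (a : R) (p q : Ideal R) : Prop :=
  ∀ F : Polynomial k, Polynomial.aeval a F ∈ p ↔ Polynomial.aeval a F ∈ q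

end SameImage

section Separation

variable {K k R V : Type*} [Field K] [Field k] [CommRing R] [Algebra K k] [Algebra k R]
  [Algebra K R] [IsScalarTower K k R] [AddCommGroup V] [Module K V]

/-- Two points with the same image have conjugate coordinates. -/
theorem SameImage.exists_algHom {a : R} {p q : Ideal R} [p.IsPrime] [q.IsPrime]
    [Algebra.IsAlgebraic k p.ResidueField] (h : SameImage k a p q) :
    ∃ σ : p.ResidueField →ₐ[k] AlgebraicClosure q.ResidueField,
      σ (algebraMap R p.ResidueField a) =
        algebraMap q.ResidueField _ (algebraMap R q.ResidueField a) := by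
  apply IntermediateField.exists_algHom_of_splits_of_aeval
  · intro s
    exact ⟨(Algebra.IsAlgebraic.isAlgebraic s).isIntegral, IsAlgClosed.splits _⟩
  · have h1 : Polynomial.aeval a (minpoly k (algebraMap R p.ResidueField a)) ∈ p := by
      rw [← Ideal.algebraMap_residueField_eq_zero, ← Polynomial.aeval_algebraMap_apply,
        minpoly.aeval]
    rw [h, ← Ideal.algebraMap_residueField_eq_zero, ← Polynomial.aeval_algebraMap_apply] at h1
    rw [Polynomial.aeval_algebraMap_apply, h1, map_zero]

/-- Two distinct points, one of them closed, are separated by a generic coordinate. -/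
theorem generic_not_sameImage (lam : V →ₗ[K] R)
    (hlam : Algebra.adjoin k (Set.range lam) = ⊤) {p q : Ideal R} [p.IsPrime] [q.IsPrime]
    (hpq : p ≠ q) [Module.Finite k p.ResidueField] :
    GenericProp K (fun a => ¬ SameImage k (lam a) p q) := by
  let E := AlgebraicClosure q.ResidueField
  let G : R →ₐ[k] E := (IsScalarTower.toAlgHom k q.ResidueField E).comp
    (IsScalarTower.toAlgHom k R q.ResidueField)
  let F (σ : p.ResidueField →ₐ[k] E) : R →ₐ[k] E := σ.comp (IsScalarTower.toAlgHom k R p.ResidueField)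
  have hlamsmul (c : K) (v : V) : lam (c • v) = algebraMap k R (algebraMap K k c) * lam v := by
    rw [map_smul, Algebra.smul_def, IsScalarTower.algebraMap_apply K k R]
  -- For a fixed embedding σ, the coordinates whose values at p and q correspond under σ form a
  -- K-subspace. It is proper, since the coordinates generate R and p ≠ q.
  let S (σ : p.ResidueField →ₐ[k] E) : Submodule K V :=
    { carrier := {v | F σ (lam v) = G (lam v)}
      add_mem' := fun {a b} ha hb => by
        simp only [Set.mem_ofPred_eq] at ha hb ⊢
        rw [map_add, map_add, map_add, ha, hb]
      zero_mem' := by simp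
      smul_mem' := fun c v hv => by
        simp only [Set.mem_ofPred_eq] at hv ⊢
        rw [hlamsmul, map_mul, map_mul, AlgHom.commutes, AlgHom.commutes, hv] }
  have hS (σ) : S σ ≠ ⊤ := by
    intro htop
    have hFG : F σ = G := by
      apply AlgHom.ext_of_adjoin_eq_top hlam
      rintro _ ⟨v, rfl⟩
      have : v ∈ S σ := htop ▸ Submodule.mem_top
      exact this
    apply hpq
    ext x
    have h1 : F σ x = 0 ↔ x ∈ p := by
      rw [← Ideal.algebraMap_residueField_eq_zero]
      exact map_eq_zero σ
    have h2 : G x = 0 ↔ x ∈ q := by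
      rw [← Ideal.algebraMap_residueField_eq_zero]
      exact map_eq_zero (algebraMap q.ResidueField E)
    rw [← h1, ← h2, hFG]
  -- Finiteness of the residue field of p leaves finitely many embeddings, hence finitely many
  -- subspaces.
  have hfin : Finite (p.ResidueField →ₐ[k] E) := inferInstance
  refine (GenericProp.forall_mem (Set.finite_univ) (fun σ _ => GenericProp.notMem (hS σ))).mono ?_
  intro a ha hsame
  obtain ⟨σ, hσ⟩ := hsame.exists_algHom
  exact ha σ trivial hσ

end Separation

/-! ### Derivations along algebraic extensions in characteristic zero -/

section DerivationExtension

/-- The fraction field is a localization, and an algebraic extension of it is separable in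
characteristic zero. -/
theorem formallyEtale_of_isAlgebraic (T L : Type*) [CommRing T] [IsDomain T] [Field L] [CharZero L]
    [Algebra T L] [FaithfulSMul T L] [Algebra.IsAlgebraic T L] : Algebra.FormallyEtale T L := by
  let F := FractionRing T
  let : Algebra F L := FractionRing.liftAlgebra T L
  have : IsScalarTower T F L := FractionRing.isScalarTower_liftAlgebra T L
  have : Algebra.IsAlgebraic F L := Algebra.IsAlgebraic.extendScalars (R := T) (IsFractionRing.injective T F)
  have : CharZero T := ⟨fun m n h => by
    have := congr(algebraMap T L $h)
    simpa using this⟩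
  have : CharZero F := charZero_of_injective_algebraMap (IsFractionRing.injective T F)
  have : Algebra.FormallyEtale T F := Algebra.FormallyEtale.of_isLocalization (nonZeroDivisors T)
  have : Algebra.FormallyEtale F L := Algebra.FormallyEtale.of_isSeparable F L
  exact Algebra.FormallyEtale.comp T F L

variable {k T L M : Type*} [CommRing k] [CommRing T] [CommRing L] [Algebra k T] [Algebra k L]
  [Algebra T L] [IsScalarTower k T L] [AddCommGroup M] [Module k M] [Module T M] [Module L M]
  [IsScalarTower T L M] [IsScalarTower k L M]

-- The difference of the two derivations is T-linear, so it factors through Ω[L⁄T] = 0.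
omit [Algebra k T] [IsScalarTower k T L] [IsScalarTower k L M] in
theorem Derivation.eq_of_formallyUnramified [Algebra.FormallyUnramified T L]
    (D₁ D₂ : Derivation k L M)
    (h : ∀ t : T, D₁ (algebraMap T L t) = D₂ (algebraMap T L t)) : D₁ = D₂ := by
  let δ : Derivation T L M :=
    { toFun := fun x => D₁ x - D₂ x
      map_add' := fun x y => by simp only [map_add]; abel
      map_smul' := fun t x => by
        simp only [Algebra.smul_def, Derivation.leibniz, h, RingHom.id_apply]
        rw [← algebraMap_smul L t (D₁ x - D₂ x), smul_sub]; abel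
      map_one_eq_zero' := by simp
      leibniz' := fun a b => by
        change D₁ (a * b) - D₂ (a * b) = a • (D₁ b - D₂ b) + b • (D₁ a - D₂ a)
        simp only [Derivation.leibniz, smul_sub]; abel }
  have hδ : δ = 0 := by
    have := Algebra.FormallyUnramified.subsingleton_kaehlerDifferential (R := T) (A := L)
    rw [← Derivation.liftKaehlerDifferential_comp δ, Subsingleton.elim
      δ.liftKaehlerDifferential 0]
    ext; simp
  ext x
  have : D₁ x - D₂ x = 0 := congr($hδ x)
  exact sub_eq_zero.mp this

/-- Formal étaleness identifies Ω[L⁄k] with L ⊗ Ω[T⁄k]. -/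
theorem Derivation.exists_extend_of_formallyEtale [Algebra.FormallyEtale T L]
    [IsScalarTower k T M] (D : Derivation k T M) :
    ∃ D' : Derivation k L M, ∀ t : T, D' (algebraMap T L t) = D t := by
  let e := KaehlerDifferential.tensorKaehlerEquivOfFormallyEtale k T L
  let φ : L ⊗[T] Ω[T⁄k] →ₗ[L] M := LinearMap.liftBaseChange L D.liftKaehlerDifferential
  refine ⟨(φ ∘ₗ e.symm.toLinearMap).compDer (KaehlerDifferential.D k L), fun t => ?_⟩
  have : e.symm (KaehlerDifferential.D k L (algebraMap T L t)) =
      1 ⊗ₜ KaehlerDifferential.D k T t :=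
    KaehlerDifferential.tensorKaehlerEquivOfFormallyEtale_symm_D_algebraMap k T L t
  simp [this, φ]

end DerivationExtension

/-! ### The derivation d/db on a curve and its denominators -/

section Coordinate

variable {k : Type*} [Field k] [CharZero k]

/-- The derivation `d/db` on a field which is algebraic over `k(b)`. -/
theorem exists_coordinate_derivation {L : Type*} [Field L] [Algebra k L] [Algebra k[X] L]
    [IsScalarTower k k[X] L] [FaithfulSMul k[X] L] [Algebra.IsAlgebraic k[X] L] :
    ∃ D : Derivation k L L, D (algebraMap k[X] L Polynomial.X) = 1 ∧
      ∀ x : L, KaehlerDifferential.D k L x =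
        D x • KaehlerDifferential.D k L (algebraMap k[X] L Polynomial.X) := by
  have : CharZero L := charZero_of_injective_algebraMap (algebraMap k L).injective
  have := formallyEtale_of_isAlgebraic k[X] L
  obtain ⟨D, hD⟩ := Derivation.exists_extend_of_formallyEtale (L := L)
    (Polynomial.mkDerivation k (1 : L))
  have hX : D (algebraMap k[X] L Polynomial.X) = 1 := by simp [hD]
  refine ⟨D, hX, fun x => ?_⟩
  have key := Derivation.eq_of_formallyUnramified (T := k[X]) (KaehlerDifferential.D k L)
    ((LinearMap.toSpanSingleton L _
      (KaehlerDifferential.D k L (algebraMap k[X] L Polynomial.X))).compDer D) ?_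
  · exact congr($key x)
  · intro t
    have h2 : ((KaehlerDifferential.D k L).compAlgebraMap k[X]) =
        (((LinearMap.toSpanSingleton L _
      (KaehlerDifferential.D k L (algebraMap k[X] L Polynomial.X))).compDer D).compAlgebraMap
        k[X]) := by
      apply Polynomial.derivation_ext
      simp [hX]
    exact congr($h2 t)

omit [CharZero k] in
/-- Clearing denominators in `dx = (dx/db) db`. -/
theorem exists_integral_coordinate_derivation {R : Type*} [CommRing R] [IsDomain R] [Algebra k R]
    [Algebra.FiniteType k R] {b : R} {L : Type*} [Field L] [Algebra k L] [Algebra R L]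
    [IsScalarTower k R L] [IsFractionRing R L] (D : Derivation k L L)
    (hD : ∀ x : L, KaehlerDifferential.D k L x =
        D x • KaehlerDifferential.D k L (algebraMap R L b)) :
    ∃ (f : R) (D₀ : Derivation k R R), f ≠ 0 ∧
      (∀ x, algebraMap R L (D₀ x) = algebraMap R L f * D (algebraMap R L x)) ∧
      ∀ x, f • KaehlerDifferential.D k R x = D₀ x • KaehlerDifferential.D k R b := by
  classical
  let ι := KaehlerDifferential.map k k R L
  let φ : Ω[L⁄k] →ₗ[L] L := D.liftKaehlerDifferential
  have hφ (ω : Ω[L⁄k]) : ω = φ ω • KaehlerDifferential.D k L (algebraMap R L b) := by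
    have : (LinearMap.id : Ω[L⁄k] →ₗ[L] Ω[L⁄k]) = (LinearMap.toSpanSingleton L _
      (KaehlerDifferential.D k L (algebraMap R L b))) ∘ₗ φ := by
      apply LinearMap.ext_on (KaehlerDifferential.span_range_derivation k L)
      rintro _ ⟨x, rfl⟩
      simp [φ, ← hD x]
    exact congr($this ω)
  obtain ⟨t, ht⟩ := (Module.Finite.fg_top : (⊤ : Submodule R Ω[R⁄k]).FG)
  obtain ⟨f₁, hf₁⟩ := IsLocalization.exist_integer_multiples_of_finset (nonZeroDivisors R)
    (t.image fun ω => φ (ι ω))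
  have hf₁0 : (f₁ : R) ≠ 0 := nonZeroDivisors.coe_ne_zero f₁
  let ψ₀ : Ω[R⁄k] →ₗ[R] L := (f₁ : R) • ((φ.restrictScalars R) ∘ₗ ι)
  have hψ₀ (ω) : ψ₀ ω ∈ LinearMap.range (Algebra.linearMap R L) := by
    have : (⊤ : Submodule R Ω[R⁄k]) ≤ (LinearMap.range (Algebra.linearMap R L)).comap ψ₀ := by
      rw [← ht, Submodule.span_le]
      intro ω hω
      obtain ⟨r, hr⟩ := hf₁ (φ (ι ω)) (Finset.mem_image_of_mem _ hω)
      exact ⟨r, hr⟩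
    exact this trivial
  let ψ : Ω[R⁄k] →ₗ[R] R :=
    (LinearEquiv.ofInjective (Algebra.linearMap R L) (IsFractionRing.injective R L)).symm.toLinearMap
      ∘ₗ ψ₀.codRestrict _ hψ₀
  have hψ (ω) : algebraMap R L (ψ ω) = (f₁ : R) • φ (ι ω) := by
    have := LinearEquiv.ofInjective_symm_apply (f := Algebra.linearMap R L)
      (h := IsFractionRing.injective R L) ⟨ψ₀ ω, hψ₀ ω⟩
    exact this
  -- Θ measures the failure of the desired identity. Its values vanish over the fraction field, so
  -- they are torsion, and f₂ annihilates those at the finitely many generators.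
  let Θ : Ω[R⁄k] →ₗ[R] Ω[R⁄k] :=
    (f₁ : R) • LinearMap.id - (LinearMap.toSpanSingleton R _ (KaehlerDifferential.D k R b)) ∘ₗ ψ
  have hΘ (ω) : ∃ s : nonZeroDivisors R, s • Θ ω = 0 := by
    apply (IsLocalizedModule.eq_zero_iff (nonZeroDivisors R) ι).mp
    have h1 : ι (ψ ω • KaehlerDifferential.D k R b) = (f₁ : R) • ι ω := by
      conv_rhs => rw [hφ (ι ω)]
      rw [map_smul, KaehlerDifferential.map_D, ← algebraMap_smul L (ψ ω), hψ, smul_assoc]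
    simp [Θ, h1]
  choose s hs using hΘ
  let f₂ : R := ∏ ω ∈ t, (s ω : R)
  have hf₂0 : f₂ ≠ 0 := Finset.prod_ne_zero_iff.mpr fun ω _ => nonZeroDivisors.coe_ne_zero _
  have hf₂ (ω) : f₂ • Θ ω = 0 := by
    have : (⊤ : Submodule R Ω[R⁄k]) ≤ LinearMap.ker (f₂ • Θ) := by
      rw [← ht, Submodule.span_le]
      intro ω hω
      obtain ⟨c, hc⟩ := Finset.dvd_prod_of_mem (fun ω => (s ω : R)) hω
      have h3 : (s ω : R) • Θ ω = 0 := hs ω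
      change f₂ • Θ ω = 0
      change f₂ = _ at hc
      rw [hc, mul_comm, mul_smul, h3, smul_zero]
    exact this trivial
  refine ⟨f₂ * f₁, (f₂ • ψ).compDer (KaehlerDifferential.D k R), mul_ne_zero hf₂0 hf₁0, ?_, ?_⟩
  · intro x
    simp [hψ, ι, φ, Algebra.smul_def, mul_assoc]
  · intro x
    have := hf₂ (KaehlerDifferential.D k R x)
    simp only [Θ, LinearMap.sub_apply, LinearMap.smul_apply, LinearMap.id_apply, smul_sub,
      LinearMap.comp_apply, LinearMap.toSpanSingleton_apply] at this
    rw [sub_eq_zero] at this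
    rw [mul_smul, this]
    simp [mul_smul]

end Coordinate

/-! ### Constants of a derivation -/

section Constants

variable {k L : Type*} [Field k] [CharZero k] [Field L] [Algebra k L] [Algebra k[X] L]
    [IsScalarTower k k[X] L] [FaithfulSMul k[X] L] [Algebra.IsAlgebraic k[X] L]

/-- The constants of `d/db` are algebraic. -/
theorem isAlgebraic_of_derivation_eq_zero (D : Derivation k L L) (hD : D ≠ 0) {a : L}
    (ha : D a = 0) : IsAlgebraic k a := by
  by_contra htr
  have : CharZero L := charZero_of_injective_algebraMap (algebraMap k L).injective
  have hX : IsTranscendenceBasis k (fun _ : Unit => algebraMap k[X] L Polynomial.X) :=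
    IsTranscendenceBasis.algebraMap_comp (A := L) (IsTranscendenceBasis.polynomial (R := k) (ι := Unit))
  have hdeg := hX.lift_cardinalMk_eq_trdeg
  have hind : AlgebraicIndependent k (fun _ : Unit => a) :=
    (algebraicIndependent_unique_type_iff).mpr htr
  -- L has transcendence degree one, so a transcendental `a` would be a transcendence basis. Then D,
  -- which vanishes on k[a], would vanish on L.
  have hbas : IsTranscendenceBasis k (fun _ : Unit => a) := by
    refine hind.isTranscendenceBasis_of_lift_trdeg_le_of_finite ?_
    rw [← hdeg]
  have halg := hbas.isAlgebraic
  have := formallyEtale_of_isAlgebraic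
    (Algebra.adjoin k (Set.range (fun _ : Unit => a))) L
  apply hD
  apply Derivation.eq_of_formallyUnramified
    (T := Algebra.adjoin k (Set.range (fun _ : Unit => a)))
  rintro ⟨t, ht⟩
  change D t = 0
  have : t ∈ Algebra.adjoin k (Set.range (fun _ : Unit => a)) := ht
  induction this using Algebra.adjoin_induction with
  | mem x hx => obtain ⟨_, rfl⟩ := hx; exact ha
  | algebraMap r => simp
  | add x y hx hy h1 h2 => simp [h1 hx, h2 hy]
  | mul x y hx hy h1 h2 => simp [h1 hx, h2 hy]

end Constants

/-! ### Tangents of a plane curve through a given point -/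

section Elimination

variable {k R : Type*} [Field k] [CharZero k] [CommRing R] [IsDomain R] [Algebra k R]

/-- Only finitely many points of the curve have a tangent passing through a given point, unless
the curve is a line. -/
theorem exists_eliminant {L : Type*} [Field L] [Algebra k L] [Algebra R L]
    [IsScalarTower k R L] [IsFractionRing R L] (D : Derivation k L L) {a b f : R}
    (hDb : D (algebraMap R L b) = 1) (hf : f ≠ 0) {d : R}
    (hd : algebraMap R L d = algebraMap R L f * D (algebraMap R L a))
    {κ : Type*} [Field κ] [Algebra k κ] [Module.Finite k κ] (α β : κ)
    (hDD : D (D (algebraMap R L a)) ≠ 0) :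
    ∃ N : R, N ≠ 0 ∧ ∀ {E : Type*} [Field E] [Algebra k E] (y : R →ₐ[k] E) (σ : κ →ₐ[k] E),
      y f * y a - y d * y b = y f * σ α - y d * σ β → y N = 0 := by
  let T := R ⊗[k] κ
  -- With a' = d/f, the equation n = 0 says that the tangent at the varying point passes through (α,
  -- β).
  let n : T := (f * a - d * b) ⊗ₜ 1 - f ⊗ₜ α + d ⊗ₜ β
  by_cases hN : ∃ N : R, N ≠ 0 ∧ N ⊗ₜ[k] (1 : κ) ∈ Ideal.span {n}
  · obtain ⟨N, hN0, hN⟩ := hN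
    refine ⟨N, hN0, fun {E} _ _ y σ h => ?_⟩
    obtain ⟨t, ht⟩ := Ideal.mem_span_singleton'.mp hN
    let F : T →ₐ[k] E := Algebra.TensorProduct.lift y σ (fun _ _ => Commute.all _ _)
    have hF (r : R) (x : κ) : F (r ⊗ₜ x) = y r * σ x :=
      Algebra.TensorProduct.lift_tmul y σ (fun _ _ => Commute.all _ _) r x
    have h1 : F n = 0 := by
      simp only [n, map_add, map_sub, hF, map_mul, map_one, mul_one]
      linear_combination h
    have h2 : F (N ⊗ₜ 1) = y N := by rw [hF, map_one, mul_one]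
    rw [← h2, ← ht, map_mul, h1, mul_zero]
  · exfalso
    push Not at hN
    let S : Submonoid T := (nonZeroDivisors R).map
      (Algebra.TensorProduct.includeLeft : R →ₐ[k] T).toRingHom.toMonoidHom
    have hdis : Disjoint (Ideal.span {n} : Set T) S := by
      rw [Set.disjoint_left]
      rintro _ hx ⟨r, hr, rfl⟩
      exact hN r (nonZeroDivisors.ne_zero hr) hx
    -- If n divides no nonzero element of R, there is a prime over the generic point of the curve
    -- containing n. In its residue field M, algebraic over L, the tangent relation holds
    -- identically.
    obtain ⟨𝔭, h𝔭, hle, hdisj⟩ := Ideal.exists_le_prime_disjoint _ S hdis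
    let M := 𝔭.ResidueField
    have hinj : Function.Injective (algebraMap R M) := by
      rw [injective_iff_map_eq_zero]
      intro r hr
      by_contra hr0
      rw [IsScalarTower.algebraMap_apply R T M, Ideal.algebraMap_residueField_eq_zero] at hr
      exact Set.disjoint_left.mp hdisj hr ⟨r, mem_nonZeroDivisors_of_ne_zero hr0, rfl⟩
    have : FaithfulSMul R M := (faithfulSMul_iff_algebraMap_injective R M).mpr hinj
    let : Algebra L M := (IsFractionRing.lift (K := L) hinj).toAlgebra
    have : IsScalarTower R L M := .of_algebraMap_eq fun r =>
      (IsFractionRing.lift_algebraMap hinj r).symm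
    have : IsScalarTower k L M := .of_algebraMap_eq fun r => by
      rw [IsScalarTower.algebraMap_apply k R L, ← IsScalarTower.algebraMap_apply R L M,
        ← IsScalarTower.algebraMap_apply k R M]
    have : Algebra.IsIntegral R T := inferInstance
    have : Algebra.IsIntegral R (T ⧸ 𝔭) := Algebra.IsIntegral.of_surjective
      (IsScalarTower.toAlgHom R T (T ⧸ 𝔭)) Ideal.Quotient.mk_surjective
    have : Nontrivial (T ⧸ 𝔭) := inferInstance
    have : Algebra.IsAlgebraic R (T ⧸ 𝔭) := Algebra.IsIntegral.isAlgebraic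
    have : Algebra.IsAlgebraic R M := by
      exact (IsFractionRing.isAlgebraic_iff' R (T ⧸ 𝔭) M).mp this
    have : Algebra.IsAlgebraic L M := Algebra.IsAlgebraic.extendScalars (R := R)
      (IsFractionRing.injective R L)
    have : CharZero M := charZero_of_injective_algebraMap (algebraMap k M).injective
    have : CharZero κ := charZero_of_injective_algebraMap (algebraMap k κ).injective
    have := formallyEtale_of_isAlgebraic L M
    have := formallyEtale_of_isAlgebraic k κ
    obtain ⟨D', hD'⟩ := Derivation.exists_extend_of_formallyEtale (L := M)
      ((Algebra.linearMap L M).compDer D)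
    have hD'' (x : L) : D' (algebraMap L M x) = algebraMap L M (D x) := hD' x
    let : Algebra κ M := ((algebraMap T M).comp
      (Algebra.TensorProduct.includeRight : κ →ₐ[k] T).toRingHom).toAlgebra
    have hκ (x : κ) : algebraMap κ M x = algebraMap T M (1 ⊗ₜ x) := rfl
    have : IsScalarTower k κ M := .of_algebraMap_eq fun r => by
      rw [hκ, IsScalarTower.algebraMap_apply k T M]
      congr 1
      rw [← mul_one (algebraMap k κ r), ← Algebra.smul_def, ← TensorProduct.smul_tmul,
        Algebra.TensorProduct.algebraMap_apply, Algebra.smul_def, mul_one]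
    -- Since κ is finite over k in characteristic zero, the k-derivation D' kills it: α and β are
    -- constants.
    have hconst (x : κ) : D' (algebraMap κ M x) = 0 := by
      have := Derivation.eq_of_formallyUnramified (T := k) (D'.compAlgebraMap κ) 0 (by simp)
      exact congr($this x)
    have hn : algebraMap T M n = 0 := by
      rw [Ideal.algebraMap_residueField_eq_zero]
      exact hle (Ideal.mem_span_singleton_self n)
    have hR (r : R) (x : κ) : algebraMap T M (r ⊗ₜ x) = algebraMap R M r * algebraMap κ M x := by
      have : (r ⊗ₜ x : T) = (r ⊗ₜ 1) * (1 ⊗ₜ x) := by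
        rw [Algebra.TensorProduct.tmul_mul_tmul, mul_one, one_mul]
      rw [hκ, IsScalarTower.algebraMap_apply R T M, this, map_mul]
      rfl
    simp only [n, map_add, map_sub, hR, map_mul, map_one, mul_one] at hn
    have hfM : algebraMap R M f ≠ 0 := by simpa using hf
    set a' := D (algebraMap R L a) with ha'
    have hdM : algebraMap R M d = algebraMap R M f * algebraMap L M a' := by
      rw [IsScalarTower.algebraMap_apply R L M, hd, map_mul, ← IsScalarTower.algebraMap_apply]
    rw [hdM] at hn
    have h1 : algebraMap R M a = algebraMap κ M α +
        algebraMap L M a' * (algebraMap R M b - algebraMap κ M β) := by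
      apply mul_left_cancel₀ hfM
      linear_combination hn
    have hDa : D' (algebraMap R M a) = algebraMap L M a' := by
      rw [IsScalarTower.algebraMap_apply R L M, hD'']
    have hDb' : D' (algebraMap R M b) = 1 := by
      rw [IsScalarTower.algebraMap_apply R L M, hD'', hDb, map_one]
    -- Differentiating a = α + a'(b - β) gives a' = a' + a''(b - β); moreover b is not constant,
    -- because its derivative is 1.
    have h2 := congr(D' $h1)
    rw [hDa] at h2
    simp only [map_add, Derivation.leibniz, map_sub, hconst, hDb', hD'', smul_eq_mul] at h2
    have h3 : (algebraMap R M b - algebraMap κ M β) * algebraMap L M (D a') = 0 := by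
      linear_combination -h2
    rcases mul_eq_zero.mp h3 with h3 | h3
    · have := congr(D' $h3)
      simp [hconst, hDb'] at this
    · exact hDD (by simpa using h3)

end Elimination

/-! ### Domains integral over a principal ideal domain -/

section IntegralOverPID

variable {T R : Type*} [CommRing T] [IsDomain T] [IsPrincipalIdealRing T] [CommRing R] [IsDomain R]

/-- In a domain, a nonzero element of y has an integral equation with nonzero constant term, and
this term lies in y. -/
theorem comap_ne_bot_of_isIntegral {S : Type*} [CommRing S] {φ : S →+* R} (hφ : φ.IsIntegral)
    {y : Ideal R} (hy : y ≠ ⊥) : y.comap φ ≠ RingHom.ker φ := by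
  algebraize [φ]
  have : Algebra.IsIntegral S R := ⟨hφ⟩
  obtain ⟨x, hxy, hx⟩ := Submodule.exists_mem_ne_zero_of_ne_bot hy
  have := Ideal.comap_lt_comap_of_integral_mem_sdiff (R := S) (I := ⊥) (J := y) bot_le
    (x := x) ⟨hxy, by simpa using hx⟩ (Algebra.IsIntegral.isIntegral x)
  exact (ne_of_lt this).symm

/-- The contraction of y is a nonzero prime of a principal ideal domain, hence maximal, and
maximality lifts along integral maps. -/
theorem isMaximal_of_isIntegral_of_ne_bot {φ : T →+* R} (hφ : φ.IsIntegral) {y : Ideal R}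
    [y.IsPrime] (hy : y ≠ ⊥) : y.IsMaximal := by
  have h1 := comap_ne_bot_of_isIntegral hφ hy
  have h2 : y.comap φ ≠ ⊥ := by
    intro h
    apply h1
    rw [h, eq_comm, eq_bot_iff, ← h]
    intro x hx
    rw [RingHom.mem_ker] at hx
    simp [hx]
  have h3 : (y.comap φ).IsMaximal := (inferInstance : (y.comap φ).IsPrime).isMaximal h2
  algebraize [φ]
  have : Algebra.IsIntegral T R := ⟨hφ⟩
  exact Ideal.isMaximal_of_isIntegral_of_isMaximal_comap (R := T) y h3

/-- A nonzero kernel would be a maximal ideal, equal to the contraction of y, against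
`comap_ne_bot_of_isIntegral`. The existence of y is what rules out dimension zero. -/
theorem injective_of_isIntegral {φ : T →+* R} (hφ : φ.IsIntegral) {y : Ideal R}
    [y.IsPrime] (hy : y ≠ ⊥) : Function.Injective φ := by
  rw [RingHom.injective_iff_ker_eq_bot]
  by_contra hker
  have : (RingHom.ker φ).IsPrime := RingHom.ker_isPrime φ
  have hm := this.isMaximal hker
  have h1 := comap_ne_bot_of_isIntegral hφ hy
  apply h1
  refine (hm.eq_of_le (inferInstance : (y.comap φ).IsPrime).ne_top fun x hx => ?_).symm
  rw [RingHom.mem_ker] at hx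
  simp [hx]

-- Every prime containing f is minimal over (f), and a Noetherian ring has finitely many of these.
omit [IsDomain R] in
theorem finite_primes_of_mem [IsNoetherianRing R]
    (hmax : ∀ y : PrimeSpectrum R, y.asIdeal ≠ ⊥ → y.asIdeal.IsMaximal) {f : R} (hf : f ≠ 0) :
    {y : PrimeSpectrum R | f ∈ y.asIdeal}.Finite := by
  apply Set.Finite.of_finite_image (f := PrimeSpectrum.asIdeal) _
    (fun x _ y _ h => PrimeSpectrum.ext h)
  refine (Ideal.finite_minimalPrimes_of_isNoetherianRing R (Ideal.span {f})).subset ?_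
  rintro _ ⟨y, hy, rfl⟩
  refine ⟨⟨y.2, by simpa [Ideal.span_le] using hy⟩, fun z ⟨hz, hfz⟩ hzy => ?_⟩
  have hz0 : z ≠ ⊥ := by
    rintro rfl
    exact hf (by simpa using hfz (Ideal.mem_span_singleton_self f))
  exact ((hmax ⟨z, hz⟩ hz0).eq_of_le y.2.ne_top hzy).ge

theorem finite_residueField_of_isMaximal (k : Type*) [Field k] {R : Type*} [CommRing R]
    [Algebra k R] [Algebra.FiniteType k R] (y : Ideal R) [y.IsMaximal] :
    Module.Finite k y.ResidueField := by
  have h : Function.Surjective (algebraMap R y.ResidueField) := by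
    rw [IsScalarTower.algebraMap_eq R (R ⧸ y) y.ResidueField]
    exact (Ideal.bijective_algebraMap_quotient_residueField y).2.comp Ideal.Quotient.mk_surjective
  have : Algebra.FiniteType k y.ResidueField :=
    Algebra.FiniteType.of_surjective (IsScalarTower.toAlgHom k R y.ResidueField) h
  exact finite_of_finite_type_of_isJacobsonRing k y.ResidueField

end IntegralOverPID

/-! ### Finiteness of the bad slopes in a pencil -/

section Slopes

variable {k R L : Type*} [Field k] [CharZero k] [CommRing R] [IsDomain R] [Algebra k R]
  [Algebra.FiniteType k R] [Field L] [Algebra k L] [Algebra R L] [IsScalarTower k R L]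
  [IsFractionRing R L]

-- If u ≠ 0, its minimal polynomial has nonzero constant term P₀. Scaling its roots by f gives an
-- equation for r whose constant term is P₀ times a power of f; this term is divisible by r, hence
-- lies in y, although f does not.
omit [CharZero k] [IsDomain R] [Algebra.FiniteType k R] in
theorem algebraMap_eq_of_isAlgebraic_of_mem {y : Ideal R} [y.IsPrime] {f r : R} (hf : f ∉ y)
    (hr : r ∈ y) {u : L} (hu : IsAlgebraic k u) (h : algebraMap R L r = algebraMap R L f * u) :
    u = 0 := by
  by_contra hu0
  let P := minpoly k u
  have hP0 : P.coeff 0 ≠ 0 := minpoly.coeff_zero_ne_zero hu.isIntegral hu0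
  let Q : R[X] := (P.map (algebraMap k R)).scaleRoots f
  have hQ : Q.eval r = 0 := by
    apply IsFractionRing.injective R L
    rw [map_zero, ← Polynomial.eval₂_at_apply, h, Polynomial.scaleRoots_eval₂_mul,
      Polynomial.eval₂_map, ← IsScalarTower.algebraMap_eq]
    have : Polynomial.eval₂ (algebraMap k L) u P = 0 := minpoly.aeval k u
    rw [this, mul_zero]
  have h1 := Polynomial.sub_dvd_eval_sub r 0 Q
  rw [hQ, sub_zero, zero_sub, dvd_neg, ← Polynomial.coeff_zero_eq_eval_zero,
    Polynomial.coeff_scaleRoots, Polynomial.coeff_map] at h1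
  have h2 := y.mem_of_dvd h1 hr
  rcases Ideal.IsPrime.mem_or_mem ‹_› h2 with h3 | h3
  · exact Ideal.IsPrime.ne_top ‹_› (Ideal.eq_top_of_isUnit_mem y h3
      ((IsUnit.mk0 _ hP0).map (algebraMap k R)))
  · exact hf (Ideal.IsPrime.mem_of_pow_mem ‹_› _ h3)

/-- For almost all slopes `t`, the projection `a - t b` has no critical point on the fibre of a
given point, outside the critical points of `b`. -/
theorem finite_bad_slopes [Algebra k[X] L] [IsScalarTower k k[X] L] [FaithfulSMul k[X] L]
    [Algebra.IsAlgebraic k[X] L]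
    (hmax : ∀ y : PrimeSpectrum R, y.asIdeal ≠ ⊥ → y.asIdeal.IsMaximal)
    {a b f : R} {D : Derivation k L L} {D₀ : Derivation k R R}
    (hDb : D (algebraMap R L b) = 1) (hf : f ≠ 0)
    (hD₀ : ∀ x, algebraMap R L (D₀ x) = algebraMap R L f * D (algebraMap R L x))
    (hfD : ∀ x, f • KaehlerDifferential.D k R x = D₀ x • KaehlerDifferential.D k R b)
    (c : Ideal R) [c.IsPrime] [Module.Finite k c.ResidueField] :
    {t : k | ∃ y : PrimeSpectrum R, f ∉ y.asIdeal ∧ SameImage k (a - t • b) y.asIdeal c ∧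
      ∃ δ : Derivation k R y.asIdeal.ResidueField, δ (a - t • b) = 0 ∧ δ ≠ 0}.Finite := by
  have : IsNoetherianRing R := Algebra.FiniteType.isNoetherianRing k R
  -- At a critical point of a - t b away from f = 0, the derivative da/db takes the value t.
  have key (t : k) (y : PrimeSpectrum R) (hfy : f ∉ y.asIdeal)
      (δ : Derivation k R y.asIdeal.ResidueField) (hδ : δ (a - t • b) = 0) (hδ0 : δ ≠ 0) :
      D₀ a - t • f ∈ y.asIdeal := by
    have h1 (x : R) : f • δ x = D₀ x • δ b := by
      have := congr(δ.liftKaehlerDifferential $(hfD x))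
      simpa using this
    have hfy' : algebraMap R y.asIdeal.ResidueField f ≠ 0 := by
      rwa [Ne, Ideal.algebraMap_residueField_eq_zero]
    have hb : δ b ≠ 0 := by
      intro hb
      apply hδ0
      ext x
      have := h1 x
      rw [hb, smul_zero, Algebra.smul_def] at this
      simpa using (mul_eq_zero.mp this).resolve_left hfy'
    have ha : δ a = t • δ b := by
      rw [map_sub, Derivation.map_smul] at hδ
      exact sub_eq_zero.mp hδ
    have h2 := h1 a
    rw [ha] at h2
    rw [← Ideal.algebraMap_residueField_eq_zero]
    apply (mul_eq_zero.mp (_ : _ * δ b = 0)).resolve_right hb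
    rw [map_sub, sub_mul, ← Algebra.smul_def, ← h2, ← Algebra.smul_def, smul_assoc,
      smul_comm, sub_self]
  -- If a'' = 0, then a' - t is algebraic over k and vanishes at a point, so t = a' is the only
  -- candidate.
  by_cases hDD : D (D (algebraMap R L a)) = 0
  · have hD0 : D ≠ 0 := by
      rintro rfl
      simp at hDb
    have halg := isAlgebraic_of_derivation_eq_zero D hD0 hDD
    refine Set.Finite.subset (s := {t : k | algebraMap k L t = D (algebraMap R L a)})
      (Set.Subsingleton.finite ?_) ?_
    · intro t ht t' ht'
      exact (algebraMap k L).injective (ht.trans ht'.symm)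
    · rintro t ⟨y, hfy, -, δ, hδ, hδ0⟩
      have h1 := key t y hfy δ hδ hδ0
      have h2 : D (algebraMap R L a) - algebraMap k L t = 0 := by
        refine algebraMap_eq_of_isAlgebraic_of_mem hfy h1
          (halg.sub (isAlgebraic_algebraMap t)) ?_
        rw [map_sub, hD₀, Algebra.smul_def, map_mul, ← IsScalarTower.algebraMap_apply]
        ring
      exact (sub_eq_zero.mp h2).symm
  · obtain ⟨N, hN0, hN⟩ := exists_eliminant D (a := a) hDb hf (hD₀ a)
      (algebraMap R c.ResidueField a) (algebraMap R c.ResidueField b) hDD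
    have hfin := finite_primes_of_mem hmax hN0
    refine (hfin.biUnion (t := fun y => {t : k | f ∉ y.asIdeal ∧ D₀ a - t • f ∈ y.asIdeal})
      fun y _ => Set.Subsingleton.finite ?_).subset ?_
    · rintro t ⟨hfy, ht⟩ t' ⟨-, ht'⟩
      by_contra hne
      have h1 : (t' - t) • f ∈ y.asIdeal := by
        convert y.asIdeal.sub_mem ht ht' using 1
        module
      have h2 := y.asIdeal.smul_of_tower_mem (t' - t)⁻¹ h1
      rw [smul_smul, inv_mul_cancel₀ (sub_ne_zero.mpr (Ne.symm hne)), one_smul] at h2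
      exact hfy h2
    · rintro t ⟨y, hfy, hsame, δ, hδ, hδ0⟩
      have h1 := key t y hfy δ hδ hδ0
      -- At the generic point, a' = t would hold identically, contradicting a'' ≠ 0.
      have hy0 : y.asIdeal ≠ ⊥ := by
        intro hy
        rw [hy, Ideal.mem_bot, sub_eq_zero] at h1
        apply hDD
        have h2 := hD₀ a
        rw [h1, Algebra.smul_def, map_mul, mul_comm, ← IsScalarTower.algebraMap_apply] at h2
        rw [← mul_left_cancel₀ (by simpa using hf) h2]
        simp
      have := hmax y hy0
      have := finite_residueField_of_isMaximal k y.asIdeal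
      obtain ⟨σ, hσ⟩ := hsame.exists_algHom
      simp only [Set.mem_iUnion]
      refine ⟨y, ?_, hfy, h1⟩
      let E := AlgebraicClosure c.ResidueField
      -- The critical equation a'(y) = t together with equality of a - t b at y and at c is the
      -- tangent relation eliminated by N.
      have h3 := hN (σ.comp (IsScalarTower.toAlgHom k R y.asIdeal.ResidueField))
        (IsScalarTower.toAlgHom k c.ResidueField E) (by
          have h4 : σ (algebraMap R _ (D₀ a)) = algebraMap k E t * σ (algebraMap R _ f) := by
            rw [← Ideal.algebraMap_residueField_eq_zero, map_sub, sub_eq_zero] at h1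
            rw [h1, Algebra.smul_def, map_mul, map_mul, ← IsScalarTower.algebraMap_apply,
              AlgHom.commutes]
          simp only [Algebra.smul_def, map_sub, map_mul, ← IsScalarTower.algebraMap_apply k R,
            AlgHom.commutes] at hσ
          have hE : algebraMap c.ResidueField E (algebraMap k c.ResidueField t) =
            algebraMap k E t := (IsScalarTower.algebraMap_apply k c.ResidueField E t).symm
          rw [hE] at hσ
          simp only [AlgHom.comp_apply, IsScalarTower.coe_toAlgHom', h4]
          linear_combination (σ (algebraMap R _ f)) * hσ)
      change N ∈ y.asIdeal
      rw [← Ideal.algebraMap_residueField_eq_zero]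
      exact (map_eq_zero σ).mp h3

end Slopes

/-! ### Projections of an affine curve unramified along a fibre -/

section Curve

variable {K k R V : Type*} [Field K] [Field k] [CharZero k] [CommRing R] [IsDomain R] [Algebra K k]
  [Algebra k R] [Algebra K R] [IsScalarTower K k R] [AddCommGroup V] [Module K V]
  [Algebra.FiniteType k R]

/-- A generic linear projection of an affine curve is unramified on the fibre of a given point at
which the curve has a cotangent space of dimension at most one. -/
theorem exists_unramified_projection (lam : V →ₗ[K] R)
    (hlam : Algebra.adjoin k (Set.range lam) = ⊤) {Q : V → Prop} (hQ : GenericProp K Q)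
    (hint : ∀ v, Q v → (Polynomial.aeval (R := k) (lam v)).toRingHom.IsIntegral)
    (c : Ideal R) [c.IsPrime] (hc : c ≠ ⊥)
    (hδ : ∃ δ₀ : Derivation k R c.ResidueField, ∀ δ : Derivation k R c.ResidueField,
      ∃ t : c.ResidueField, δ = t • δ₀) :
    ∃ v, Q v ∧ ∀ y : PrimeSpectrum R, SameImage k (lam v) y.asIdeal c →
      ∀ δ : Derivation k R y.asIdeal.ResidueField, δ (lam v) = 0 → δ = 0 := by
  have : CharZero K := by
    refine ⟨fun m n h => ?_⟩
    have := congr(algebraMap K k $h)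
    simpa using this
  have : IsNoetherianRing R := Algebra.FiniteType.isNoetherianRing k R
  obtain ⟨δ₀, hδ₀⟩ := hδ
  have hlam_sub (a b : V) (t : K) : lam (a - t • b) = lam a - algebraMap K k t • lam b := by
    rw [map_sub, map_smul, algebraMap_smul]
  let Vc : Submodule K V :=
    { carrier := {v | δ₀ (lam v) = 0}
      add_mem' := fun {a b} ha hb => by
        simp only [Set.mem_ofPred_eq] at ha hb ⊢
        rw [map_add, map_add, ha, hb, add_zero]
      zero_mem' := by simp
      smul_mem' := fun t v hv => by
        simp only [Set.mem_ofPred_eq] at hv ⊢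
        rw [map_smul, ← algebraMap_smul k t, Derivation.map_smul, hv, smul_zero] }
  have hVc : δ₀ ≠ 0 → Vc ≠ ⊤ := by
    intro h0 htop
    apply h0
    apply Derivation.ext_of_adjoin_eq_top _ hlam
    rintro _ ⟨v, rfl⟩
    have : v ∈ Vc := htop ▸ Submodule.mem_top
    exact this
  have hVc' : GenericProp K (fun v => δ₀ ≠ 0 → v ∉ Vc) := by
    by_cases h0 : δ₀ = 0
    · exact GenericProp.of_forall fun v h => absurd h0 h
    · exact (GenericProp.notMem (hVc h0)).mono fun v hv _ => hv
  -- The conditions known in advance are secured by the direction b, for every origin a. The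
  -- separation conditions depend on f, hence on b, and are left to the origin.
  obtain ⟨b, hQb, hlineb, hVb⟩ := (hQ.and (hQ.line_direction.and hVc'.line_direction)).exists_of_infinite
  have hintb := hint b hQb
  have hinj := injective_of_isIntegral hintb hc
  have hmax : ∀ y : PrimeSpectrum R, y.asIdeal ≠ ⊥ → y.asIdeal.IsMaximal := fun y hy =>
    isMaximal_of_isIntegral_of_ne_bot hintb hy
  have : c.IsMaximal := hmax ⟨c, ‹_›⟩ hc
  have := finite_residueField_of_isMaximal k c
  let L := FractionRing R
  let : Algebra k[X] R := (Polynomial.aeval (R := k) (lam b)).toRingHom.toAlgebra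
  have hX : algebraMap k[X] R Polynomial.X = lam b := Polynomial.aeval_X (lam b)
  have : IsScalarTower k k[X] R := .of_algebraMap_eq fun r =>
    ((Polynomial.aeval (R := k) (lam b)).commutes r).symm
  have : Algebra.IsIntegral k[X] R := ⟨hintb⟩
  have : FaithfulSMul k[X] R := (faithfulSMul_iff_algebraMap_injective k[X] R).mpr hinj
  have halg : Algebra.IsAlgebraic k[X] R := Algebra.IsIntegral.isAlgebraic
  have : FaithfulSMul k[X] L := .trans k[X] R L
  have : Algebra.IsAlgebraic k[X] L := (IsFractionRing.isAlgebraic_iff' k[X] R L).mp halg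
  obtain ⟨D, hDb, hD⟩ := exists_coordinate_derivation (k := k) (L := L)
  rw [IsScalarTower.algebraMap_apply k[X] R L, hX] at hDb hD
  obtain ⟨f, D₀, hf, hD₀, hfD⟩ := exists_integral_coordinate_derivation D hD
  have hfin := finite_primes_of_mem hmax hf
  have hsep : GenericProp K (fun a => ∀ y ∈ {y : PrimeSpectrum R | f ∈ y.asIdeal}, ∀ b,
      {t : K | ¬ (y.asIdeal ≠ c → ¬ SameImage k (lam (a - t • b)) y.asIdeal c)}.Finite) := by
    refine GenericProp.forall_mem hfin fun y hy => ?_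
    apply GenericProp.line_origin (p := fun a => y.asIdeal ≠ c → ¬ SameImage k (lam a) y.asIdeal c)
    by_cases hyc : y.asIdeal = c
    · exact GenericProp.of_forall fun v h => absurd hyc h
    · have hy0 : y.asIdeal ≠ ⊥ := by
        intro h
        rw [Set.mem_ofPred_eq, h] at hy
        exact hf hy
      have := hmax y hy0
      have := finite_residueField_of_isMaximal k y.asIdeal
      exact (generic_not_sameImage lam hlam hyc).mono fun v hv _ => hv
  obtain ⟨a, ha⟩ := hsep.exists_of_infinite
  have hbad := finite_bad_slopes hmax (a := lam a) hDb hf hD₀ hfD c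
  -- Bad slopes are finite in number in k; only slopes from K are wanted, so that a - t b still
  -- comes from V.
  have hbad' := hbad.preimage (f := algebraMap K k) (algebraMap K k).injective.injOn
  have hall := (((hlineb a).union (hVb a)).union hbad').union
    (hfin.biUnion fun y hy => ha y hy b)
  obtain ⟨t, ht⟩ := hall.exists_notMem
  simp only [Set.mem_union, not_or, Set.mem_iUnion, not_exists, Set.mem_ofPred_eq, not_not,
    Set.mem_preimage] at ht
  obtain ⟨⟨⟨ht1, ht2⟩, ht3⟩, ht4⟩ := ht
  refine ⟨a - t • b, ht1, fun y hy δ hδ => ?_⟩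
  -- Among the zeros of f, separation leaves only y = c, where every derivation is a multiple of δ₀
  -- and a nonzero δ₀ does not kill the chosen coordinate.
  by_cases hfy : f ∈ y.asIdeal
  · have hyc : y.asIdeal = c := by
      by_contra hyc
      exact ht4 y hfy hyc hy
    obtain ⟨y, hyp⟩ := y
    change y = c at hyc
    subst hyc
    obtain ⟨s, rfl⟩ := hδ₀ δ
    by_cases h0 : δ₀ = 0
    · rw [h0, smul_zero]
    · have h1 : δ₀ (lam (a - t • b)) ≠ 0 := ht2 h0
      have h2 : s * δ₀ (lam (a - t • b)) = 0 := hδ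
      rw [(mul_eq_zero.mp h2).resolve_right h1, zero_smul]
  · by_contra hne
    rw [hlam_sub] at hy hδ
    exact ht3 y ⟨hfy, hy, δ, hδ, hne⟩

end Curve

/-! ### Pointwise criteria for unramified and étale -/

section Etale

/-- Derivations into the residue field are the dual of the fibre of Ω at y; when this fibre
vanishes, y is outside the support of Ω. -/
theorem isUnramifiedAt_of_derivation {T R : Type*} [CommRing T] [CommRing R] [Algebra T R]
    [Algebra.EssFiniteType T R] (y : Ideal R) [y.IsPrime]
    (h : ∀ δ : Derivation T R y.ResidueField, δ = 0) : Algebra.IsUnramifiedAt T y := by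
  change (⟨y, ‹_›⟩ : PrimeSpectrum R) ∈ Algebra.unramifiedLocus T R
  rw [Algebra.unramifiedLocus_eq_compl_support, Set.mem_compl_iff,
    Module.mem_support_iff_nontrivial_residueField_tensorProduct, not_nontrivial_iff_subsingleton]
  let κ := y.ResidueField
  change Subsingleton (κ ⊗[R] Ω[R⁄T])
  rw [← Module.subsingleton_dual_iff (K := κ)]
  refine ⟨fun φ ψ => ?_⟩
  have key (φ : κ ⊗[R] Ω[R⁄T] →ₗ[κ] κ) : φ = 0 := by
    let l : Ω[R⁄T] →ₗ[R] κ := (φ.restrictScalars R) ∘ₗ (TensorProduct.mk R κ Ω[R⁄T] 1)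
    have hl : l = 0 := by
      apply Derivation.liftKaehlerDifferential_unique
      rw [h (l.compDer _)]
      ext; simp
    ext ω
    simpa [l] using congr($hl (KaehlerDifferential.D T R ω))
  rw [key φ, key ψ]

/-- Passing to the localization R does not change the local ring at y, and A → A' is itself formally
étale. -/
theorem isEtaleAt_of_localization {A A' B R : Type*} [CommRing A] [CommRing A'] [CommRing B]
    [CommRing R] [Algebra A A'] [Algebra A B] [Algebra B R] [Algebra A' R] [Algebra A R]
    [IsScalarTower A A' R] [IsScalarTower A B R] (S : Submonoid A) [IsLocalization S A']
    (M : Submonoid B) [IsLocalization M R] (y' : Ideal R) [y'.IsPrime]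
    [Algebra.IsEtaleAt A' y'] (y : Ideal B) [y.IsPrime] (hy : y'.comap (algebraMap B R) = y) :
    Algebra.IsEtaleAt A y := by
  subst hy
  have : Algebra.FormallyEtale A A' := Algebra.FormallyEtale.of_isLocalization S
  have : Algebra.FormallyEtale A (Localization.AtPrime y') := Algebra.FormallyEtale.comp A A' _
  have : IsLocalization.AtPrime (Localization.AtPrime y') (y'.comap (algebraMap B R)) :=
    IsLocalization.isLocalization_isLocalization_atPrime_isLocalization M _ y'
  exact Algebra.FormallyEtale.of_equiv
    ((IsLocalization.algEquiv (y'.comap (algebraMap B R)).primeCompl (Localization.AtPrime y')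
      (Localization.AtPrime (y'.comap (algebraMap B R)))).restrictScalars A)

end Etale

/-! ### The generic fibre of the first coordinate -/

section GenericFibre

variable {K k B R : Type*} [Field K] [Field k] [Algebra K[X] k] [IsFractionRing K[X] k]
  [CommRing B] [Algebra K B] [Algebra K[X] B] [IsScalarTower K K[X] B] [CommRing R] [Algebra B R]
  [Algebra k R] [Algebra K[X] R] [IsScalarTower K[X] k R] [IsScalarTower K[X] B R]
  [IsLocalization (Algebra.algebraMapSubmonoid B (nonZeroDivisors K[X])) R]

/-- The denominators in R come from K[X], so they are scalars of k. -/
theorem exists_smul_algebraMap_eq (K : Type*) {k B R : Type*} [Field K] [Field k] [Algebra K[X] k]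
    [IsFractionRing K[X] k] [CommRing B] [Algebra K[X] B] [CommRing R] [Algebra B R]
    [Algebra k R] [Algebra K[X] R] [IsScalarTower K[X] k R] [IsScalarTower K[X] B R]
    [IsLocalization (Algebra.algebraMapSubmonoid B (nonZeroDivisors K[X])) R] (x : R) :
    ∃ (q : k) (b : B), x = q • algebraMap B R b := by
  obtain ⟨⟨b, ⟨_, F, hF, rfl⟩⟩, h⟩ := IsLocalization.surj
    (Algebra.algebraMapSubmonoid B (nonZeroDivisors K[X])) x
  have hF0 : algebraMap K[X] k F ≠ 0 := by
    simpa using nonZeroDivisors.ne_zero hF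
  refine ⟨(algebraMap K[X] k F)⁻¹, b, ?_⟩
  simp only at h
  rw [← h, ← IsScalarTower.algebraMap_apply, IsScalarTower.algebraMap_apply K[X] k R, mul_comm,
    ← Algebra.smul_def, smul_smul, inv_mul_cancel₀ hF0, one_smul]

theorem adjoin_image_eq_top {s : Set B} (hs : Algebra.adjoin K s = ⊤) :
    Algebra.adjoin k (algebraMap B R '' s) = ⊤ := by
  rw [eq_top_iff]
  rintro x -
  obtain ⟨q, b, rfl⟩ := exists_smul_algebraMap_eq K (k := k) (B := B) x
  apply Subalgebra.smul_mem
  have hb : b ∈ Algebra.adjoin K s := hs ▸ Algebra.mem_top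
  induction hb using Algebra.adjoin_induction with
  | mem x hx => exact Algebra.subset_adjoin ⟨x, hx, rfl⟩
  | algebraMap r =>
    rw [IsScalarTower.algebraMap_apply K K[X] B, ← IsScalarTower.algebraMap_apply K[X] B R,
      IsScalarTower.algebraMap_apply K[X] k R]
    exact Subalgebra.algebraMap_mem _ _
  | add x y _ _ hx hy => rw [map_add]; exact Subalgebra.add_mem _ hx hy
  | mul x y _ _ hx hy => rw [map_mul]; exact Subalgebra.mul_mem _ hx hy

/-- The morphism from the affine plane given by two elements of an algebra. -/
noncomputable def planeHom (K : Type*) {B : Type*} [Field K] [CommRing B] [Algebra K B]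
    (a₁ a₂ : B) : K[X][X] →+* B :=
  Polynomial.eval₂RingHom (Polynomial.aeval (R := K) a₁).toRingHom a₂

theorem planeHom_C {K B : Type*} [Field K] [CommRing B] [Algebra K B] (a₁ a₂ : B) (F : K[X]) :
    planeHom K a₁ a₂ (Polynomial.C F) = Polynomial.aeval a₁ F := by
  simp [planeHom]

theorem planeHom_X {K B : Type*} [Field K] [CommRing B] [Algebra K B] (a₁ a₂ : B) :
    planeHom K a₁ a₂ Polynomial.X = a₂ := by
  simp [planeHom]

omit [IsFractionRing K[X] k] [IsScalarTower K K[X] B]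
  [IsLocalization (Algebra.algebraMapSubmonoid B (nonZeroDivisors K[X])) R] in
theorem algebraMap_planeHom {a₁ : B} (ha₁ : ∀ F : K[X], algebraMap K[X] B F = Polynomial.aeval a₁ F)
    (a₂ : B) (H : K[X][X]) : algebraMap B R (planeHom K a₁ a₂ H) =
      Polynomial.aeval (algebraMap B R a₂) (H.map (algebraMap K[X] k)) := by
  have : (algebraMap B R).comp (planeHom K a₁ a₂) =
      (Polynomial.aeval (R := k) (algebraMap B R a₂)).toRingHom.comp
        (Polynomial.mapRingHom (algebraMap K[X] k)) := by
    apply Polynomial.ringHom_ext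
    · intro F
      simp [planeHom_C, ← ha₁, ← IsScalarTower.algebraMap_apply]
    · simp [planeHom_X]
  exact congr($this H)

omit [IsScalarTower K K[X] B] in
theorem isIntegral_genericFibre {a₁ : B}
    (ha₁ : ∀ F : K[X], algebraMap K[X] B F = Polynomial.aeval a₁ F) {a₂ : B}
    (h : (planeHom K a₁ a₂).IsIntegral) :
    (Polynomial.aeval (R := k) (algebraMap B R a₂)).toRingHom.IsIntegral := by
  intro x
  obtain ⟨q, b, rfl⟩ := exists_smul_algebraMap_eq K (k := k) (B := B) x
  rw [Algebra.smul_def]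
  refine RingHom.IsIntegralElem.mul _ ?_ ?_
  · have : algebraMap k R q =
        (Polynomial.aeval (R := k) (algebraMap B R a₂)).toRingHom (Polynomial.C q) := by simp
    rw [this]
    exact RingHom.isIntegralElem_map _
  · obtain ⟨p, hp, hpb⟩ := h b
    refine ⟨p.map (Polynomial.mapRingHom (algebraMap K[X] k)), hp.map _, ?_⟩
    rw [Polynomial.eval₂_map]
    have : (Polynomial.aeval (R := k) (algebraMap B R a₂)).toRingHom.comp
        (Polynomial.mapRingHom (algebraMap K[X] k)) = (algebraMap B R).comp (planeHom K a₁ a₂) := by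
      exact RingHom.ext fun H => (algebraMap_planeHom ha₁ a₂ H).symm
    rw [this, ← Polynomial.hom_eval₂, hpb, map_zero]

-- Polynomials over k can be cleared of denominators, which are units of R and so do not affect
-- membership in primes.
omit [IsLocalization (Algebra.algebraMapSubmonoid B (nonZeroDivisors K[X])) R]
  [IsScalarTower K K[X] B] in
theorem sameImage_genericFibre {a₁ : B}
    (ha₁ : ∀ F : K[X], algebraMap K[X] B F = Polynomial.aeval a₁ F) {a₂ : B} {y' c' : Ideal R}
    [y'.IsPrime] [c'.IsPrime]
    (h : (y'.comap (algebraMap B R)).comap (planeHom K a₁ a₂) =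
      (c'.comap (algebraMap B R)).comap (planeHom K a₁ a₂)) :
    SameImage k (algebraMap B R a₂) y' c' := by
  intro G
  obtain ⟨F, hF, hH⟩ := IsLocalization.integerNormalization_spec (nonZeroDivisors K[X]) G
  set H := IsLocalization.integerNormalization (nonZeroDivisors K[X]) G
  have hF0 : IsUnit (algebraMap k R (algebraMap K[X] k F)) := by
    apply IsUnit.map
    exact IsUnit.mk0 _ (by simpa using nonZeroDivisors.ne_zero hF)
  have key (p : Ideal R) [p.IsPrime] : Polynomial.aeval (algebraMap B R a₂) G ∈ p ↔
      H ∈ (p.comap (algebraMap B R)).comap (planeHom K a₁ a₂) := by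
    have h1 : algebraMap B R (planeHom K a₁ a₂ H) =
        algebraMap k R (algebraMap K[X] k F) * Polynomial.aeval (algebraMap B R a₂) G := by
      rw [algebraMap_planeHom (k := k) ha₁, hH, ← algebraMap_smul k F G, map_smul, Algebra.smul_def]
    rw [Ideal.mem_comap, Ideal.mem_comap, h1, Ideal.unit_mul_mem_iff_mem _ hF0]
  rw [key y', key c', h]

end GenericFibre

/-! ### Projections of an affine surface étale along a fibre -/

section Surface

theorem flat_of_faithfulSMul (T R : Type*) [CommRing T] [IsDedekindDomain T] [CommRing R]
    [IsDomain R] [Algebra T R] [FaithfulSMul T R] : Module.Flat T R :=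
  have : Module.IsTorsionFree T R := inferInstance
  inferInstance

attribute [local instance] Polynomial.algebra Polynomial.isLocalization in
/-- A generic linear projection of an affine surface to the plane is étale along the fibre of the
generic point of a curve, at which the surface has a cotangent space of dimension two. -/
theorem exists_etale_projection {K B V : Type*} [Field K] [CharZero K] [CommRing B] [IsDomain B]
    [Algebra K B] [Algebra.FiniteType K B] [AddCommGroup V] [Module K V] (lam : V →ₗ[K] B)
    (hlam : Algebra.adjoin K (Set.range lam) = ⊤) {a₁ : B} {Q : V → Prop} (hQ : GenericProp K Q)
    (hint : ∀ v, Q v → (planeHom K a₁ (lam v)).IsIntegral) (c : Ideal B) [c.IsPrime] (hc : c ≠ ⊥)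
    (hca : ∀ F : K[X], Polynomial.aeval a₁ F ∈ c → F = 0)
    (hΩ : ∃ x₀ : B, ∀ x : B, ∃ s ∉ c, ∃ r₁ r₀ : B, s • KaehlerDifferential.D K B x =
      r₁ • KaehlerDifferential.D K B a₁ + r₀ • KaehlerDifferential.D K B x₀) :
    ∃ v, Q v ∧ Function.Injective (planeHom K a₁ (lam v)) ∧
      ∀ y : PrimeSpectrum B,
        y.asIdeal.comap (planeHom K a₁ (lam v)) = c.comap (planeHom K a₁ (lam v)) →
        ∃ f ∉ y.asIdeal,
          ((algebraMap B (Localization.Away f)).comp (planeHom K a₁ (lam v))).Etale := by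
  let : Algebra K[X] B := (Polynomial.aeval (R := K) a₁).toRingHom.toAlgebra
  have ha₁ (F : K[X]) : algebraMap K[X] B F = Polynomial.aeval a₁ F := rfl
  have : IsScalarTower K K[X] B := .of_algebraMap_eq fun r => by simp [ha₁]
  let k := FractionRing K[X]
  let M := Algebra.algebraMapSubmonoid B (nonZeroDivisors K[X])
  have hinj : Function.Injective (algebraMap K[X] B) := by
    rw [injective_iff_map_eq_zero]
    intro F hF
    exact hca F (by rw [← ha₁, hF]; exact c.zero_mem)
  have hM : M ≤ nonZeroDivisors B := by
    rintro _ ⟨F, hF, rfl⟩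
    exact mem_nonZeroDivisors_of_ne_zero ((map_ne_zero_iff _ hinj).mpr
      (nonZeroDivisors.ne_zero hF))
  let R := Localization M
  have hBR : Function.Injective (algebraMap B R) := IsLocalization.injective R hM
  have : IsDomain R := IsLocalization.isDomain_localization hM
  have hinjR : Function.Injective (algebraMap K[X] R) := by
    rw [IsScalarTower.algebraMap_eq K[X] B R]
    exact hBR.comp hinj
  have hunits (F : nonZeroDivisors K[X]) : IsUnit (algebraMap K[X] R F) := by
    rw [IsScalarTower.algebraMap_apply K[X] B R]
    exact IsLocalization.map_units R (⟨_, F, F.2, rfl⟩ : M)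
  let : Algebra k R := (IsLocalization.lift (S := k) hunits).toAlgebra
  have : IsScalarTower K[X] k R := .of_algebraMap_eq fun F =>
    (IsLocalization.lift_eq hunits F).symm
  have : IsScalarTower K k R := .of_algebraMap_eq fun r => by
    rw [IsScalarTower.algebraMap_apply K B R, IsScalarTower.algebraMap_apply K K[X] B,
      ← IsScalarTower.algebraMap_apply K[X] B R, IsScalarTower.algebraMap_apply K[X] k R,
      ← IsScalarTower.algebraMap_apply K K[X] k]
  have : CharZero k := charZero_of_injective_algebraMap (algebraMap K k).injective
  let lamR : V →ₗ[K] R := (Algebra.linearMap B R).restrictScalars K ∘ₗ lam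
  have hlamR (v : V) : lamR v = algebraMap B R (lam v) := rfl
  have hadj : Algebra.adjoin k (Set.range lamR) = ⊤ := by
    rw [← adjoin_image_eq_top (k := k) (R := R) hlam, ← Set.range_comp]
    rfl
  have : Algebra.FiniteType k R := by
    obtain ⟨s, hs⟩ := (Algebra.FiniteType.out : (⊤ : Subalgebra K B).FG)
    classical
    refine ⟨s.image (algebraMap B R), ?_⟩
    rw [Finset.coe_image]
    exact adjoin_image_eq_top hs
  have hprime (y : PrimeSpectrum B) (hy : ∀ F : K[X], Polynomial.aeval a₁ F ∈ y.asIdeal → F = 0) :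
      (y.asIdeal.map (algebraMap B R)).IsPrime ∧
        (y.asIdeal.map (algebraMap B R)).comap (algebraMap B R) = y.asIdeal := by
    have hdis : Disjoint (M : Set B) y.asIdeal := by
      rw [Set.disjoint_left]
      rintro _ ⟨F, hF, rfl⟩ hFy
      exact nonZeroDivisors.ne_zero hF (hy F hFy)
    exact ⟨IsLocalization.isPrime_of_isPrime_disjoint M R _ y.2 hdis,
      IsLocalization.under_map_of_isPrime_disjoint M R y.2 hdis⟩
  obtain ⟨hc'p, hc'c⟩ := hprime ⟨c, ‹_›⟩ hca
  set c' := c.map (algebraMap B R) with hc'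
  change c'.IsPrime at hc'p
  change c'.comap (algebraMap B R) = c at hc'c
  have hc'0 : c' ≠ ⊥ := by
    intro h
    apply hc
    rw [← hc'c, h, eq_bot_iff]
    intro x hx
    simpa using hBR ((Ideal.mem_bot.mp hx).trans (map_zero _).symm)
  obtain ⟨x₀, hx₀⟩ := hΩ
  -- A k-derivation kills a₁, so of the two generating differentials at c only that of x₀ matters.
  have hδ₀ (δ : Derivation k R c'.ResidueField) (hδ : δ (algebraMap B R x₀) = 0) : δ = 0 := by
    have : IsScalarTower K R c'.ResidueField := inferInstance
    let δ' : Derivation K B c'.ResidueField := (δ.restrictScalars K).compAlgebraMap B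
    have h1 : δ' a₁ = 0 := by
      have : algebraMap B R a₁ = algebraMap k R (algebraMap K[X] k Polynomial.X) := by
        rw [← IsScalarTower.algebraMap_apply, IsScalarTower.algebraMap_apply K[X] B R, ha₁,
          Polynomial.aeval_X]
      change δ (algebraMap B R a₁) = 0
      rw [this, Derivation.map_algebraMap]
    apply Derivation.ext_of_adjoin_eq_top _ hadj
    rintro _ ⟨v, rfl⟩
    obtain ⟨s, hs, r₁, r₀, h⟩ := hx₀ (lam v)
    have h2 := congr(δ'.liftKaehlerDifferential $h)
    simp only [map_smul, map_add, Derivation.liftKaehlerDifferential_comp_D, h1] at h2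
    have h3 : δ' x₀ = 0 := hδ
    rw [h3, smul_zero, smul_zero, add_zero, ← algebraMap_smul R s, Algebra.smul_def] at h2
    refine (mul_eq_zero.mp h2).resolve_left ?_
    rw [Ideal.algebraMap_residueField_eq_zero]
    rwa [← Ideal.mem_comap, hc'c]
  have hδ : ∃ δ₀ : Derivation k R c'.ResidueField, ∀ δ : Derivation k R c'.ResidueField,
      ∃ t : c'.ResidueField, δ = t • δ₀ := by
    by_cases h : ∃ δ₀ : Derivation k R c'.ResidueField, δ₀ ≠ 0
    · obtain ⟨δ₀, h0⟩ := h
      have h1 : δ₀ (algebraMap B R x₀) ≠ 0 := fun h1 => h0 (hδ₀ _ h1)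
      refine ⟨δ₀, fun δ => ⟨δ (algebraMap B R x₀) / δ₀ (algebraMap B R x₀), ?_⟩⟩
      rw [← sub_eq_zero]
      apply hδ₀
      simp [h1]
    · push Not at h
      exact ⟨0, fun δ => ⟨0, by rw [h δ, smul_zero]⟩⟩
  obtain ⟨v, hQv, hv⟩ := exists_unramified_projection lamR hadj hQ
    (fun v hv => isIntegral_genericFibre ha₁ (hint v hv)) c' hc'0 hδ
  have hintv := isIntegral_genericFibre (k := k) (R := R) ha₁ (hint v hQv)
  have hinjv := injective_of_isIntegral hintv hc'0
  have hπ : Function.Injective (planeHom K a₁ (lam v)) := by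
    rw [injective_iff_map_eq_zero]
    intro H hH
    have h1 := algebraMap_planeHom (k := k) (R := R) ha₁ (lam v) H
    rw [hH, map_zero] at h1
    have h2 := hinjv ((map_zero _).trans h1)
    apply Polynomial.map_injective (algebraMap K[X] k) (IsFractionRing.injective _ _)
    rw [← h2, Polynomial.map_zero]
  refine ⟨v, hQv, hπ, fun y hy => ?_⟩
  -- A point with the same plane image as c has the same first coordinate, transcendental over K, so
  -- it lies on the generic fibre.
  have hya (F : K[X]) (hF : Polynomial.aeval a₁ F ∈ y.asIdeal) : F = 0 := by
    apply hca
    have : Polynomial.C F ∈ y.asIdeal.comap (planeHom K a₁ (lam v)) := by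
      rwa [Ideal.mem_comap, planeHom_C]
    rwa [hy, Ideal.mem_comap, planeHom_C] at this
  obtain ⟨hy'p, hy'y⟩ := hprime y hya
  set y' := y.asIdeal.map (algebraMap B R) with hy'
  have hder := hv ⟨y', hy'p⟩ (sameImage_genericFibre ha₁ (by rw [hy'y, hc'c, hy]))
  let : Algebra k[X] R := (Polynomial.aeval (R := k) (lamR v)).toRingHom.toAlgebra
  have hX : algebraMap k[X] R Polynomial.X = lamR v := Polynomial.aeval_X (lamR v)
  have : IsScalarTower k k[X] R := .of_algebraMap_eq fun r =>
    ((Polynomial.aeval (R := k) (lamR v)).commutes r).symm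
  have : FaithfulSMul k[X] R := (faithfulSMul_iff_algebraMap_injective k[X] R).mpr hinjv
  have : Algebra.FiniteType k[X] R := Algebra.FiniteType.of_restrictScalars_finiteType k k[X] R
  have : Algebra.FinitePresentation k[X] R := Algebra.FinitePresentation.of_finiteType.mp this
  -- A domain containing k[X] is torsion-free over it, hence flat; this turns unramified into étale.
  have : Module.Flat k[X] R := flat_of_faithfulSMul k[X] R
  have : Algebra.IsUnramifiedAt k[X] y' := by
    apply isUnramifiedAt_of_derivation
    intro δ
    have h1 : δ.restrictScalars k = 0 := by
      apply hder
      change δ (lamR v) = 0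
      rw [← hX, Derivation.map_algebraMap]
    ext x
    exact congr($h1 x)
  have : Algebra.IsEtaleAt k[X] y' := Algebra.IsEtaleAt.of_isUnramifiedAt_of_flat y'
  let : Algebra K[X][X] B := (planeHom K a₁ (lam v)).toAlgebra
  have : IsScalarTower K[X][X] B R := inferInstance
  have : IsScalarTower K[X][X] k[X] R := .of_algebraMap_eq fun H =>
    algebraMap_planeHom ha₁ (lam v) H
  have : Algebra.IsEtaleAt K[X][X] y.asIdeal :=
    isEtaleAt_of_localization (A' := k[X]) (R := R) ((nonZeroDivisors K[X]).map Polynomial.C) M y' _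
      hy'y
  have : IsScalarTower K K[X][X] B := .of_algebraMap_eq fun r => by
    change algebraMap K B r = planeHom K a₁ (lam v) (Polynomial.C (Polynomial.C r))
    rw [planeHom_C, Polynomial.aeval_C]
  have : Algebra.FiniteType K[X][X] B := Algebra.FiniteType.of_restrictScalars_finiteType K K[X][X] B
  have : Algebra.FinitePresentation K[X][X] B := Algebra.FinitePresentation.of_finiteType.mp this
  obtain ⟨f, hf, het⟩ := Algebra.exists_etale_of_isEtaleAt (R := K[X][X]) y.asIdeal
  refine ⟨f, hf, ?_⟩
  rw [← RingHom.etale_algebraMap] at het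
  exact het

end Surface

/-! ### The cotangent space at a smooth point -/

section Cotangent

variable {K B V : Type*} [Field K] [CharZero K] [CommRing B] [IsDomain B]
    [Algebra K B] [AddCommGroup V] [Module K V]

/-- L is algebraic over the subring generated by a₁ and a₂, so modulo da₁ and da₂ the universal
derivation vanishes. -/
theorem finrank_kaehlerDifferential_le_two {L : Type*} [Field L] [Algebra K L] [Algebra B L]
    [IsScalarTower K B L] [IsFractionRing B L] {a₁ a₂ : B} (h : (planeHom K a₁ a₂).IsIntegral) :
    Module.finrank L Ω[L⁄K] ≤ 2 := by
  classical
  have : CharZero L := charZero_of_injective_algebraMap (algebraMap K L).injective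
  let T := (planeHom K a₁ a₂).range
  have : Algebra.IsIntegral T B := ⟨fun x => by
    obtain ⟨p, hp, hpx⟩ := h x
    refine ⟨p.map (planeHom K a₁ a₂).rangeRestrict, hp.map _, ?_⟩
    rw [Polynomial.eval₂_map]
    exact hpx⟩
  have halg : Algebra.IsAlgebraic T B := Algebra.IsIntegral.isAlgebraic
  have : FaithfulSMul T L := by
    rw [faithfulSMul_iff_algebraMap_injective, IsScalarTower.algebraMap_eq T B L]
    exact (IsFractionRing.injective B L).comp Subtype.val_injective
  have : Algebra.IsAlgebraic T L := (IsFractionRing.isAlgebraic_iff' T B L).mp halg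
  have := formallyEtale_of_isAlgebraic T L
  let d := KaehlerDifferential.D K L
  let N : Submodule L Ω[L⁄K] := Submodule.span L
    (({d (algebraMap B L a₁), d (algebraMap B L a₂)} : Finset Ω[L⁄K]) : Set Ω[L⁄K])
  have hN : N = ⊤ := by
    have h1 := Derivation.eq_of_formallyUnramified (T := T) (N.mkQ.compDer d) 0 (by
      rintro ⟨_, H, rfl⟩
      change N.mkQ (d (algebraMap B L (planeHom K a₁ a₂ H))) = 0
      have h2 (F : K[X]) : N.mkQ (d (algebraMap B L (Polynomial.aeval a₁ F))) = 0 := by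
        rw [← Polynomial.aeval_algebraMap_apply, Derivation.map_aeval, map_smul]
        have : N.mkQ (d (algebraMap B L a₁)) = 0 :=
          (Submodule.Quotient.mk_eq_zero N).mpr (Submodule.subset_span (by simp))
        rw [this, smul_zero]
      induction H using Polynomial.induction_on' with
      | add p q hp hq => simp only [map_add, hp, hq, add_zero]
      | monomial n F =>
        have : N.mkQ (d (algebraMap B L a₂)) = 0 :=
          (Submodule.Quotient.mk_eq_zero N).mpr (Submodule.subset_span (by simp))
        rw [← Polynomial.C_mul_X_pow_eq_monomial, map_mul, map_pow, planeHom_C, planeHom_X,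
          map_mul, map_pow, Derivation.leibniz, Derivation.leibniz_pow]
        simp only [map_add, LinearMap.map_smul, map_nsmul, h2, this, smul_zero, add_zero])
    have h3 : N.mkQ = 0 := by
      apply LinearMap.ext_on (KaehlerDifferential.span_range_derivation K L)
      rintro _ ⟨x, rfl⟩
      exact congr($h1 x)
    rw [← Submodule.ker_mkQ N, h3, LinearMap.ker_zero]
  rw [← finrank_top, ← hN]
  exact (finrank_span_finset_le_card _).trans Finset.card_le_two

/-- At a smooth point of a surface, a generic coordinate is part of a system of two coordinates. -/
theorem generic_exists_coordinates [Algebra.FiniteType K B] (lam : V →ₗ[K] B)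
    (hlam : Algebra.adjoin K (Set.range lam) = ⊤) {a₁ a₂ : B}
    (h : (planeHom K a₁ a₂).IsIntegral) (c : Ideal B) [c.IsPrime]
    [Algebra.FormallySmooth K (Localization.AtPrime c)] :
    GenericProp K (fun v => ∃ x₀ : B, ∀ x : B, ∃ s ∉ c, ∃ r₁ r₀ : B,
      s • KaehlerDifferential.D K B x =
        r₁ • KaehlerDifferential.D K B (lam v) + r₀ • KaehlerDifferential.D K B x₀) := by
  classical
  let A := Localization.AtPrime c
  let L := FractionRing B
  let : Algebra A L := IsLocalization.localizationAlgebraOfSubmonoidLe A L c.primeCompl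
    (nonZeroDivisors B) c.primeCompl_le_nonZeroDivisors
  have : IsScalarTower B A L := IsLocalization.localization_isScalarTower_of_submonoid_le A L
    c.primeCompl (nonZeroDivisors B) c.primeCompl_le_nonZeroDivisors
  have : IsFractionRing A L := IsFractionRing.isFractionRing_of_isLocalization c.primeCompl A L
    c.primeCompl_le_nonZeroDivisors
  have : IsScalarTower K A L := .of_algebraMap_eq fun r => by
    rw [IsScalarTower.algebraMap_apply K B L, IsScalarTower.algebraMap_apply B A L,
      ← IsScalarTower.algebraMap_apply K B A]
  have : Algebra.FormallyEtale A L := Algebra.FormallyEtale.of_isLocalization (nonZeroDivisors A)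
  have : Algebra.EssFiniteType B A := .of_isLocalization _ c.primeCompl
  have : Algebra.EssFiniteType K A := .comp _ B _
  have : Module.Projective A Ω[A⁄K] := inferInstance
  have : Module.Free A Ω[A⁄K] := Module.free_of_flat_of_isLocalRing
  let κ := IsLocalRing.ResidueField A
  let E := κ ⊗[A] Ω[A⁄K]
  -- By smoothness Ω is free over the local ring, so its rank can be computed over the function
  -- field.
  have hrank : Module.finrank κ E ≤ 2 := by
    rw [Module.finrank_baseChange, ← Module.finrank_baseChange (R := L)]
    rw [(KaehlerDifferential.tensorKaehlerEquivOfFormallyEtale K A L).finrank_eq]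
    exact finrank_kaehlerDifferential_le_two h
  let dA : B → Ω[A⁄K] := fun x => KaehlerDifferential.map K K B A (KaehlerDifferential.D K B x)
  have hdA : Submodule.span A (Set.range dA) = ⊤ :=
    KaehlerDifferential.span_range_map_derivation_of_isLocalization K B A c.primeCompl
  let w : B → E := fun x => 1 ⊗ₜ dA x
  have hw : Submodule.span κ (Set.range w) = ⊤ := by
    have := Submodule.baseChange_span (R := A) (M := Ω[A⁄K]) κ (Set.range dA)
    rw [hdA, Submodule.baseChange_top, ← Set.range_comp] at this
    exact this.symm
  have hspan (v : B) (hv : Nontrivial E → w v ≠ 0) :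
      ∃ x₀, Submodule.span κ {w v, w x₀} = ⊤ := by
    by_cases htop : Submodule.span κ {w v} = ⊤
    · refine ⟨v, ?_⟩
      rw [Set.pair_eq_singleton, htop]
    · obtain ⟨x₀, hx₀⟩ : ∃ x₀, w x₀ ∉ Submodule.span κ {w v} := by
        by_contra! hcon
        apply htop
        rw [eq_top_iff, ← hw, Submodule.span_le]
        rintro _ ⟨x, rfl⟩
        exact hcon x
      have : Nontrivial E := ⟨w x₀, 0, fun h0 => hx₀ (h0 ▸ Submodule.zero_mem _)⟩
      have hind : LinearIndependent κ ![w v, w x₀] := by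
        rw [LinearIndependent.pair_iff' (hv this)]
        intro r hr
        exact hx₀ (Submodule.mem_span_singleton.mpr ⟨r, hr⟩)
      have hcard : Fintype.card (Fin 2) = Module.finrank κ E :=
        le_antisymm hind.fintype_card_le_finrank (by simpa using hrank)
      refine ⟨x₀, ?_⟩
      have := hind.span_eq_top_of_card_eq_finrank hcard
      rwa [Matrix.range_cons_cons_empty] at this
  have hcoord (v : B) (hv : Nontrivial E → w v ≠ 0) : ∃ x₀ : B, ∀ x : B, ∃ s ∉ c, ∃ r₁ r₀ : B,
      s • KaehlerDifferential.D K B x =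
        r₁ • KaehlerDifferential.D K B v + r₀ • KaehlerDifferential.D K B x₀ := by
    obtain ⟨x₀, hx₀⟩ := hspan v hv
    -- Nakayama's lemma lifts generators of the cotangent space to generators over the local ring.
    have hx₀' : Submodule.span A {dA v, dA x₀} = ⊤ := by
      rw [← IsLocalRing.map_tensorProduct_mk_eq_top, Submodule.map_span,
        ← Submodule.restrictScalars_span A κ Ideal.Quotient.mk_surjective,
        Submodule.restrictScalars_eq_top_iff, ← hx₀, Set.image_pair]
      rfl
    refine ⟨x₀, fun x => ?_⟩
    have hx : dA x ∈ Submodule.span A {dA v, dA x₀} := hx₀' ▸ Submodule.mem_top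
    obtain ⟨ρ₁, ρ₀, hρ⟩ := Submodule.mem_span_pair.mp hx
    -- The factor b clears the denominators of the coefficients; a second factor s kills the
    -- difference that becomes zero only after localizing.
    obtain ⟨b, hb⟩ := IsLocalization.exist_integer_multiples_of_finset c.primeCompl {ρ₁, ρ₀}
    obtain ⟨r₁, hr₁⟩ := hb ρ₁ (by simp)
    obtain ⟨r₀, hr₀⟩ := hb ρ₀ (by simp)
    let D := KaehlerDifferential.D K B
    have hzero : KaehlerDifferential.map K K B A ((b : B) • D x - r₁ • D v - r₀ • D x₀) = 0 := by
      simp only [map_sub, LinearMap.map_smul]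
      change (b : B) • dA x - r₁ • dA v - r₀ • dA x₀ = 0
      rw [← hρ, smul_add, ← smul_assoc, ← smul_assoc, ← hr₁, ← hr₀, algebraMap_smul,
        algebraMap_smul]
      abel
    obtain ⟨s, hs⟩ := (IsLocalizedModule.eq_zero_iff c.primeCompl _).mp hzero
    refine ⟨s * b, c.primeCompl.mul_mem s.2 b.2, s * r₁, s * r₀, ?_⟩
    have hs' : (s : B) • ((b : B) • D x - r₁ • D v - r₀ • D x₀) = 0 := hs
    rw [smul_sub, smul_sub, sub_sub, sub_eq_zero] at hs'
    simpa only [mul_smul] using hs'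
  by_cases hE : Nontrivial E
  · let S : Submodule K V :=
      { carrier := {v | w (lam v) = 0}
        add_mem' := fun {a b} ha hb => by
          simp only [Set.mem_ofPred_eq, w, dA] at ha hb ⊢
          rw [map_add, map_add, map_add, TensorProduct.tmul_add, ha, hb, add_zero]
        zero_mem' := by simp [w, dA]
        smul_mem' := fun r v hv => by
          simp only [Set.mem_ofPred_eq, w, dA] at hv ⊢
          rw [map_smul, Derivation.map_smul, ← algebraMap_smul B r, LinearMap.map_smul,
            ← algebraMap_smul A, TensorProduct.tmul_smul, hv, smul_zero] }
    have hS : S ≠ ⊤ := by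
      intro htop
      obtain ⟨e, he⟩ := exists_ne (0 : E)
      apply he
      let δ : Derivation K B E := ((TensorProduct.mk A κ Ω[A⁄K] 1).restrictScalars B ∘ₗ
        KaehlerDifferential.map K K B A).compDer (KaehlerDifferential.D K B)
      have hδ : δ = 0 := by
        apply Derivation.ext_of_adjoin_eq_top _ hlam
        rintro _ ⟨v, rfl⟩
        have : v ∈ S := htop ▸ Submodule.mem_top
        exact this
      have h0 : (⊤ : Submodule κ E) = ⊥ := by
        rw [← hw, Submodule.span_eq_bot]
        rintro _ ⟨x, rfl⟩
        exact congr($hδ x)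
      exact (Submodule.mem_bot κ).mp (h0 ▸ Submodule.mem_top)
    exact (GenericProp.notMem hS).mono fun v hv => hcoord (lam v) fun _ => hv
  · exact GenericProp.of_forall fun v => hcoord (lam v) fun h => absurd h hE

end Cotangent

/-! ### Transcendence and separation for generic coordinates -/

section Avoidance

variable {K B V : Type*} [Field K] [CommRing B] [Algebra K B] [AddCommGroup V] [Module K V]

/-- A generic coordinate is transcendental on an integral subscheme that is not a closed point. -/
theorem generic_transcendental (lam : V →ₗ[K] B)
    (hlam : Algebra.adjoin K (Set.range lam) = ⊤) (c : Ideal B) [c.IsPrime] (hc : ¬ c.IsMaximal) :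
    GenericProp K (fun v => ∀ F : K[X], Polynomial.aeval (lam v) F ∈ c → F = 0) := by
  -- The forms with value in B/c integral over K form a subspace. Were it everything, B/c would be
  -- integral over K, hence a field.
  let S : Submodule K V := (Subalgebra.toSubmodule (integralClosure K (B ⧸ c))).comap
    ((Ideal.Quotient.mkₐ K c).toLinearMap ∘ₗ lam)
  have hS : S ≠ ⊤ := by
    intro htop
    apply hc
    have h1 : ⊤ ≤ (integralClosure K (B ⧸ c)).comap (Ideal.Quotient.mkₐ K c) := by
      rw [← hlam, Algebra.adjoin_le_iff]
      rintro _ ⟨v, rfl⟩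
      have : v ∈ S := htop ▸ Submodule.mem_top
      exact this
    have : Algebra.IsIntegral K (B ⧸ c) := ⟨fun x => by
      obtain ⟨b, rfl⟩ := Ideal.Quotient.mk_surjective x
      exact h1 (Algebra.mem_top (x := b))⟩
    exact Ideal.Quotient.maximal_of_isField _
      (isField_of_isIntegral_of_isField' (Field.toIsField K))
  refine (GenericProp.notMem hS).mono fun v hv F hF => ?_
  by_contra hF0
  apply hv
  have h2 : IsAlgebraic K (Ideal.Quotient.mkₐ K c (lam v)) := by
    refine ⟨F, hF0, ?_⟩
    rw [Polynomial.aeval_algHom_apply]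
    exact Ideal.Quotient.eq_zero_iff_mem.mpr hF
  exact h2.isIntegral

/-- The image of P on the line is the closed point cut out by an irreducible polynomial; a prime
containing its pullback lies over that same point. -/
theorem sameImage_of_minpoly_mem {a : B} {P w : Ideal B} [P.IsPrime] [w.IsPrime]
    [Module.Finite K P.ResidueField]
    (h : Polynomial.aeval a (minpoly K (algebraMap B P.ResidueField a)) ∈ w) :
    SameImage K a P w := by
  have hP (F : K[X]) : Polynomial.aeval a F ∈ P ↔ minpoly K (algebraMap B P.ResidueField a) ∣ F := by
    rw [← Ideal.algebraMap_residueField_eq_zero, ← Polynomial.aeval_algebraMap_apply,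
      minpoly.dvd_iff]
  intro F
  rw [hP]
  constructor
  · rintro ⟨G, rfl⟩
    rw [map_mul]
    exact w.mul_mem_right _ h
  · intro hF
    by_contra hdvd
    have hirr : Irreducible (minpoly K (algebraMap B P.ResidueField a)) :=
      minpoly.irreducible (Algebra.IsIntegral.isIntegral _)
    obtain ⟨u, v, huv⟩ := (hirr.coprime_iff_not_dvd).mpr hdvd
    apply ‹w.IsPrime›.ne_top
    rw [Ideal.eq_top_iff_one, ← map_one (Polynomial.aeval (R := K) a), ← huv, map_add, map_mul, map_mul]
    exact w.add_mem (w.mul_mem_left _ h) (w.mul_mem_left _ hF)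

/-- A closed point off a curve on a surface is separated from the curve by a generic projection
to the plane. -/
theorem generic_separates_curve [IsDomain B] [Algebra.FiniteType K B] (lam : V →ₗ[K] B)
    (hlam : Algebra.adjoin K (Set.range lam) = ⊤)
    (hchain : ∀ p q r : Ideal B, p.IsPrime → q.IsPrime → r.IsPrime → ⊥ < p → p < q → ¬ q < r)
    (P w : Ideal B) [hPm : P.IsMaximal] [w.IsPrime] (hw : w ≠ ⊥) (hwP : ¬ w ≤ P) :
    GenericProp K fun v₁ => GenericProp K fun v₂ => ∀ y : Ideal B, y.IsPrime → w ≤ y →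
      y.comap (planeHom K (lam v₁) (lam v₂)) ≠ P.comap (planeHom K (lam v₁) (lam v₂)) := by
  have : IsNoetherianRing B := Algebra.FiniteType.isNoetherianRing K B
  have hfin : Module.Finite K P.ResidueField := finite_residueField_of_isMaximal K P
  refine (generic_not_sameImage (k := K) lam hlam (p := P) (q := w)
    (fun h => hwP h.ge)).mono fun v₁ hv₁ => ?_
  let f := Polynomial.aeval (lam v₁) (minpoly K (algebraMap B P.ResidueField (lam v₁)))
  have hfw : f ∉ w := fun h => hv₁ (sameImage_of_minpoly_mem h)
  have hfP : f ∈ P := by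
    rw [← Ideal.algebraMap_residueField_eq_zero, ← Polynomial.aeval_algebraMap_apply,
      minpoly.aeval]
  let T : Set (Ideal B) := {y | y.IsPrime ∧ w ≤ y ∧ SameImage K (lam v₁) P y}
  -- The first coordinate already separates P from the generic point of the locus of w, so f cuts
  -- this locus properly. The bound on chains makes every member of T minimal over w + (f); the
  -- second coordinate then has finitely many points to separate from P.
  have hT : T.Finite := by
    refine (Ideal.finite_minimalPrimes_of_isNoetherianRing B (w ⊔ Ideal.span {f})).subset ?_
    rintro y ⟨hy, hwy, hPy⟩
    have hle : w ⊔ Ideal.span {f} ≤ y :=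
      sup_le hwy (by rw [Ideal.span_singleton_le_iff_mem]; exact (hPy _).mp hfP)
    obtain ⟨q, hq, hqy⟩ := Ideal.exists_minimalPrimes_le hle
    have hwq : w < q := lt_of_le_of_ne (le_sup_left.trans hq.1.2) fun h =>
      hfw (h ▸ hq.1.2 (Ideal.mem_sup_right (Ideal.mem_span_singleton_self f)))
    rcases hqy.eq_or_lt with rfl | hlt
    · exact hq
    · exact absurd hlt (hchain w q y ‹_› hq.1.1 hy (bot_lt_iff_ne_bot.mpr hw) hwq)
  refine (GenericProp.forall_mem hT (p := fun y v₂ => ¬ SameImage K (lam v₂) P y) ?_).mono ?_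
  · rintro y ⟨hy, hwy, -⟩
    exact generic_not_sameImage (k := K) lam hlam fun h => hwP (h ▸ hwy)
  · intro v₂ hv₂ y hy hwy hcomap
    have h1 : SameImage K (lam v₁) P y := fun F => by
      have := SetLike.ext_iff.mp hcomap (Polynomial.C F)
      rw [Ideal.mem_comap, Ideal.mem_comap, planeHom_C] at this
      exact this.symm
    refine hv₂ y ⟨hy, hwy, h1⟩ fun F => ?_
    have h2 : planeHom K (lam v₁) (lam v₂) (F.map Polynomial.C) = Polynomial.aeval (lam v₂) F := by
      rw [planeHom, Polynomial.coe_eval₂RingHom, Polynomial.eval₂_map, Polynomial.aeval_def]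
      congr 1
      ext r
      simp
    have := SetLike.ext_iff.mp hcomap (F.map Polynomial.C)
    rw [Ideal.mem_comap, Ideal.mem_comap, h2] at this
    exact this.symm

end Avoidance

/-! ### Gluing a morphism to Proj from a graded homomorphism -/

section ProjChart

open HomogeneousLocalization

variable {A B σ τ : Type u} [CommRing A] [SetLike σ A] [AddSubgroupClass σ A]
  [CommRing B] [SetLike τ B] [AddSubgroupClass τ B]
  {𝒜 : ℕ → σ} {ℬ : ℕ → τ} [GradedRing 𝒜] [GradedRing ℬ]
  (φ : 𝒜 →+*ᵍ ℬ) {X : Scheme.{u}} (i : X ⟶ Proj ℬ)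

/-- The morphism to `Proj 𝒜` on the part of `X` where `φ s` is invertible. -/
noncomputable def projChart (s : A) {d : ℕ} (hs : s ∈ 𝒜 d) (hd : 0 < d) :
    (i ⁻¹ᵁ Proj.basicOpen ℬ (φ s)).toScheme ⟶ Proj 𝒜 :=
  i ∣_ Proj.basicOpen ℬ (φ s) ≫ Proj.basicOpenToSpec ℬ (φ s) ≫
    Spec.map (CommRingCat.ofHom (Away.map φ s)) ≫ Proj.awayι 𝒜 s hs hd

theorem awayMap_map {s t x : A} {d e : ℕ} (hs : s ∈ 𝒜 d) (ht : t ∈ 𝒜 e) (hx : x = s * t)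
    (hφx : φ x = φ s * φ t) :
    (Away.map φ x).comp (awayMap 𝒜 ht hx) =
      (awayMap ℬ (Graded.map_mem φ ht) hφx).comp (Away.map φ s) := by
  refine RingHom.ext fun a => ?_
  obtain ⟨n, a, ha, rfl⟩ := Away.mk_surjective 𝒜 hs a
  have hx' : x ∈ 𝒜 (d + e) := hx ▸ SetLike.mul_mem_graded hs ht
  simp only [RingHom.comp_apply, awayMap_mk, Away.map_mk, map_mul, map_pow]

/-- Applied with x the product of two chart elements, in both orders, this gives the agreement on
overlaps needed for gluing. -/
theorem homOfLE_projChart {s t x : A} {d e m : ℕ} (hs : s ∈ 𝒜 d) (hd : 0 < d) (ht : t ∈ 𝒜 e)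
    (hx : x = s * t) (hm : m = d + e) (hxm : x ∈ 𝒜 m) (hm0 : 0 < m)
    (hle : i ⁻¹ᵁ Proj.basicOpen ℬ (φ x) ≤ i ⁻¹ᵁ Proj.basicOpen ℬ (φ s)) :
    X.homOfLE hle ≫ projChart φ i s hs hd = projChart φ i x hxm hm0 := by
  subst hm
  have hφx : φ x = φ s * φ t := by rw [hx, map_mul]
  rw [projChart, projChart, ← Proj.SpecMap_awayMap_awayι (𝒜 := 𝒜) hs hd ht hx,
    ← Spec.map_comp_assoc, ← CommRingCat.ofHom_comp, awayMap_map φ hs ht hx hφx,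
    CommRingCat.ofHom_comp, Spec.map_comp_assoc, Proj.basicOpenToSpec_SpecMap_awayMap_assoc,
    ← Scheme.Hom.resLE_eq_morphismRestrict, ← Scheme.Hom.resLE_eq_morphismRestrict,
    Scheme.Hom.map_resLE_assoc, Scheme.Hom.resLE_map_assoc]

variable {ι : Type u} (t : ι → A) {d : ι → ℕ} (ht : ∀ j, t j ∈ 𝒜 (d j)) (hd : ∀ j, 0 < d j)

/-- The open cover of `X` by the loci where one of the `φ (t j)` does not vanish. -/
noncomputable def projChartCover (hcov : ∀ x : X, ∃ j, i x ∈ Proj.basicOpen ℬ (φ (t j))) :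
    X.OpenCover :=
  X.openCoverOfIsOpenCover (fun j => i ⁻¹ᵁ Proj.basicOpen ℬ (φ (t j))) (by
    rw [TopologicalSpace.IsOpenCover, eq_top_iff]
    intro x _
    obtain ⟨j, hj⟩ := hcov x
    exact TopologicalSpace.Opens.mem_iSup.mpr ⟨j, hj⟩)

theorem exists_glue_projChart (hcov : ∀ x : X, ∃ j, i x ∈ Proj.basicOpen ℬ (φ (t j))) :
    ∃ g : X ⟶ Proj 𝒜, ∀ j, (i ⁻¹ᵁ Proj.basicOpen ℬ (φ (t j))).ι ≫ g =
      projChart φ i (t j) (ht j) (hd j) := by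
  let U (j : ι) : X.Opens := i ⁻¹ᵁ Proj.basicOpen ℬ (φ (t j))
  have hcompat : ∀ j k : ι,
      Limits.pullback.fst (U j).ι (U k).ι ≫ projChart φ i (t j) (ht j) (hd j) =
      Limits.pullback.snd (U j).ι (U k).ι ≫ projChart φ i (t k) (ht k) (hd k) := by
    intro j k
    have he : i ⁻¹ᵁ Proj.basicOpen ℬ (φ (t j)) ⊓ i ⁻¹ᵁ Proj.basicOpen ℬ (φ (t k)) =
        i ⁻¹ᵁ Proj.basicOpen ℬ (φ (t j * t k)) := by
      rw [map_mul, Proj.basicOpen_mul]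
      rfl
    let e : Limits.pullback (U j).ι (U k).ι ≅
        (i ⁻¹ᵁ Proj.basicOpen ℬ (φ (t j * t k))).toScheme :=
      (isPullback_opens_inf _ _).isoPullback.symm ≪≫ X.isoOfEq he
    have h1 := homOfLE_projChart φ i (ht j) (hd j) (ht k) rfl rfl
      (SetLike.mul_mem_graded (ht j) (ht k)) (Nat.add_pos_left (hd j) _)
      (he ▸ inf_le_left)
    have h2 := homOfLE_projChart φ i (ht k) (hd k) (ht j) (mul_comm (t j) (t k)) (add_comm _ _)
      (SetLike.mul_mem_graded (ht j) (ht k)) (Nat.add_pos_left (hd j) _)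
      (he ▸ inf_le_right)
    have e1 : e.inv ≫ Limits.pullback.fst (U j).ι (U k).ι =
        X.homOfLE (he ▸ inf_le_left) := by
      simp [e, Scheme.isoOfEq_inv]
    have e2 : e.inv ≫ Limits.pullback.snd (U j).ι (U k).ι =
        X.homOfLE (he ▸ inf_le_right) := by
      simp [e, Scheme.isoOfEq_inv]
    rw [← cancel_epi e.inv, reassoc_of% e1, reassoc_of% e2]
    exact h1.trans h2.symm
  exact ⟨(projChartCover φ i t hcov).glueMorphisms (fun j => projChart φ i (t j) (ht j) (hd j))
    hcompat, fun j => (projChartCover φ i t hcov).ι_glueMorphisms _ hcompat j⟩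

theorem basicOpenToSpec_awayι {s : A} {d : ℕ} (hs : s ∈ 𝒜 d) (hd : 0 < d) :
    Proj.basicOpenToSpec 𝒜 s ≫ Proj.awayι 𝒜 s hs hd = (Proj.basicOpen 𝒜 s).ι := by
  rw [← Proj.basicOpenIsoSpec_hom 𝒜 s hs hd, ← Proj.basicOpenIsoSpec_inv_ι, Iso.hom_inv_id_assoc]

/-- On both sides the locus is the nonvanishing of a homogeneous quotient of a power of r by a power
of s, and φ carries one quotient to the other. -/
theorem projChart_preimage_basicOpen {s r : A} {d e : ℕ} (hs : s ∈ 𝒜 d) (hd : 0 < d)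
    (hr : r ∈ 𝒜 e) (he : 0 < e) :
    projChart φ i s hs hd ⁻¹ᵁ Proj.basicOpen 𝒜 r =
      (i ⁻¹ᵁ Proj.basicOpen ℬ (φ s)).ι ⁻¹ᵁ i ⁻¹ᵁ Proj.basicOpen ℬ (φ r) := by
  have h1 : Spec.map (CommRingCat.ofHom (Away.map φ s)) ⁻¹ᵁ
      Proj.awayι 𝒜 s hs hd ⁻¹ᵁ Proj.basicOpen 𝒜 r =
      Proj.awayι ℬ (φ s) (Graded.map_mem φ hs) hd ⁻¹ᵁ Proj.basicOpen ℬ (φ r) := by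
    rw [Proj.awayι_preimage_basicOpen 𝒜 hs hd hr he,
      Proj.awayι_preimage_basicOpen ℬ (Graded.map_mem φ hs) hd (Graded.map_mem φ hr) he]
    ext x
    change Away.map φ s (Away.isLocalizationElem hs hr) ∉ x.asIdeal ↔
      Away.isLocalizationElem (Graded.map_mem φ hs) (Graded.map_mem φ hr) ∉ x.asIdeal
    simp only [Away.isLocalizationElem, Away.map_mk, map_pow]
  rw [projChart]
  simp only [Scheme.Hom.comp_preimage]
  rw [h1, ← Scheme.Hom.comp_preimage (Proj.basicOpenToSpec ℬ (φ s)), basicOpenToSpec_awayι,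
    ← Scheme.Hom.comp_preimage, morphismRestrict_ι, Scheme.Hom.comp_preimage]

theorem preimage_basicOpen_of_projChart {g : X ⟶ Proj 𝒜}
    (hcov : ∀ x : X, ∃ j, i x ∈ Proj.basicOpen ℬ (φ (t j)))
    (hg : ∀ j, (i ⁻¹ᵁ Proj.basicOpen ℬ (φ (t j))).ι ≫ g = projChart φ i (t j) (ht j) (hd j))
    {r : A} {e : ℕ} (hr : r ∈ 𝒜 e) (he : 0 < e) :
    g ⁻¹ᵁ Proj.basicOpen 𝒜 r = i ⁻¹ᵁ Proj.basicOpen ℬ (φ r) := by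
  ext x
  obtain ⟨j, hj⟩ := hcov x
  have h := projChart_preimage_basicOpen φ i (ht j) (hd j) hr he
  rw [← hg j, Scheme.Hom.comp_preimage] at h
  exact SetLike.ext_iff.mp h ⟨x, hj⟩

theorem comp_eq_of_projChart {S : Scheme.{u}} {g : X ⟶ Proj 𝒜}
    (hcov : ∀ x : X, ∃ j, i x ∈ Proj.basicOpen ℬ (φ (t j)))
    (hg : ∀ j, (i ⁻¹ᵁ Proj.basicOpen ℬ (φ (t j))).ι ≫ g = projChart φ i (t j) (ht j) (hd j))
    (p : Proj 𝒜 ⟶ S) (q : Proj ℬ ⟶ S)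
    (hpq : ∀ j, Spec.map (CommRingCat.ofHom (Away.map φ (t j))) ≫
      Proj.awayι 𝒜 (t j) (ht j) (hd j) ≫ p =
        Proj.awayι ℬ (φ (t j)) (Graded.map_mem φ (ht j)) (hd j) ≫ q) :
    g ≫ p = i ≫ q := by
  refine (projChartCover φ i t hcov).hom_ext _ _ fun j => ?_
  change (i ⁻¹ᵁ Proj.basicOpen ℬ (φ (t j))).ι ≫ g ≫ p =
    (i ⁻¹ᵁ Proj.basicOpen ℬ (φ (t j))).ι ≫ i ≫ q
  rw [reassoc_of% (hg j), projChart]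
  simp only [Category.assoc]
  rw [hpq j, reassoc_of% (basicOpenToSpec_awayι (𝒜 := ℬ) (Graded.map_mem φ (ht j)) (hd j)),
    morphismRestrict_ι_assoc]

end ProjChart

/-! ### Linear forms as affine coordinates -/

section LinearForms

open HomogeneousLocalization ProjectiveVariety

/-- Used with r = 1/ℓ₀, to recognise a/ℓ₀ⁿ as the value of a at the functions x_k/ℓ₀. -/
theorem MvPolynomial.IsHomogeneous.eval₂_mul_left {σ R S : Type*} [Fintype σ] [CommSemiring R]
    [CommSemiring S] {p : MvPolynomial σ R} {n : ℕ} (hp : p.IsHomogeneous n) (f : R →+* S) (r : S)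
    (g : σ → S) : p.eval₂ f (fun i => r * g i) = r ^ n * p.eval₂ f g := by
  rw [MvPolynomial.eval₂_eq', MvPolynomial.eval₂_eq', Finset.mul_sum]
  refine Finset.sum_congr rfl fun d hd => ?_
  have h : ∑ i, d i = n := by
    rw [← Finsupp.degree_eq_sum, Finsupp.degree_eq_weight_one]
    exact hp (MvPolynomial.mem_support_iff.mp hd)
  simp only [mul_pow, Finset.prod_mul_distrib, Finset.prod_pow_eq_pow_sum, h]
  ring

variable {K : Type u} [Field K] {N : ℕ} {ℓ₀ : MvPolynomial (Fin (N + 1)) K}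

/-- The scalars in the coordinate ring of the chart `ℓ₀ ≠ 0`. -/
noncomputable def awayScalar (K : Type u) [Field K] (N : ℕ) (ℓ₀ : MvPolynomial (Fin (N + 1)) K) :
    K →+* Away (grading K N) ℓ₀ :=
  (fromZeroRingHom (grading K N) _).comp (algebraMap K (grading K N 0))

/-- The quotient of two linear forms as a function on the chart where the denominator does not
vanish. -/
noncomputable def formRatio (h₀ : ℓ₀ ∈ grading K N 1) (ℓ : grading K N 1) :
    Away (grading K N) ℓ₀ :=
  Away.mk (grading K N) h₀ 1 ℓ.1 (by simp)

theorem val_awayScalar (c : K) : (awayScalar K N ℓ₀ c).val =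
    algebraMap (MvPolynomial (Fin (N + 1)) K) (Localization.Away ℓ₀) (MvPolynomial.C c) := by
  rw [awayScalar, RingHom.comp_apply, ← Localization.mk_one_eq_algebraMap]
  rfl

theorem val_formRatio (h₀ : ℓ₀ ∈ grading K N 1) (ℓ : grading K N 1) :
    (formRatio h₀ ℓ).val =
      IsLocalization.Away.invSelf ℓ₀ * algebraMap _ (Localization.Away ℓ₀) ℓ.1 := by
  rw [formRatio, Away.val_mk, IsLocalization.Away.invSelf, Localization.mk_eq_mk',
    mul_comm, IsLocalization.mul_mk'_eq_mk'_of_mul, mul_one]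
  congr 1
  exact Subtype.ext (pow_one ℓ₀)

theorem formRatio_self (h₀ : ℓ₀ ∈ grading K N 1) : formRatio h₀ ⟨ℓ₀, h₀⟩ = 1 := by
  apply HomogeneousLocalization.val_injective
  rw [val_formRatio, HomogeneousLocalization.val_one, mul_comm,
    IsLocalization.Away.mul_invSelf]

theorem formRatio_add (h₀ : ℓ₀ ∈ grading K N 1) (a b : grading K N 1) :
    formRatio h₀ (a + b) = formRatio h₀ a + formRatio h₀ b := by
  apply HomogeneousLocalization.val_injective
  simp only [val_formRatio, HomogeneousLocalization.val_add, Submodule.coe_add, map_add, mul_add]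

theorem formRatio_smul (h₀ : ℓ₀ ∈ grading K N 1) (c : K) (a : grading K N 1) :
    formRatio h₀ (c • a) = awayScalar K N ℓ₀ c * formRatio h₀ a := by
  apply HomogeneousLocalization.val_injective
  rw [HomogeneousLocalization.val_mul, val_formRatio, val_formRatio, val_awayScalar,
    Submodule.coe_smul, MvPolynomial.smul_eq_C_mul, map_mul]
  ring

/-- The coordinates as linear forms. -/
noncomputable def coordForm (K : Type u) [Field K] (N : ℕ) (k : Fin (N + 1)) : grading K N 1 :=
  ⟨MvPolynomial.X k, MvPolynomial.isHomogeneous_X K k⟩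

/-- The chart `ℓ₀ ≠ 0` has coordinate ring generated by the functions `x_k / ℓ₀`. -/
theorem eval₂Hom_formRatio_surjective (h₀ : ℓ₀ ∈ grading K N 1) :
    Function.Surjective (MvPolynomial.eval₂Hom (awayScalar K N ℓ₀)
      fun k => formRatio h₀ (coordForm K N k)) := by
  intro x
  obtain ⟨n, a, ha, rfl⟩ := Away.mk_surjective (grading K N) h₀ x
  refine ⟨a, ?_⟩
  apply HomogeneousLocalization.val_injective
  have ha' : a.IsHomogeneous n := by simpa using ha
  let v : Away (grading K N) ℓ₀ →+* Localization.Away ℓ₀ := algebraMap _ _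
  change v _ = _
  rw [MvPolynomial.coe_eval₂Hom, MvPolynomial.hom_eval₂]
  have h1 : (fun k => v (formRatio h₀ (coordForm K N k))) =
      fun k => IsLocalization.Away.invSelf ℓ₀ * algebraMap (MvPolynomial (Fin (N + 1)) K)
        (Localization.Away ℓ₀) (MvPolynomial.X k) := by
    funext k
    exact val_formRatio h₀ _
  have h2 : v.comp (awayScalar K N ℓ₀) =
      (algebraMap (MvPolynomial (Fin (N + 1)) K) (Localization.Away ℓ₀)).comp MvPolynomial.C :=
    RingHom.ext fun c => val_awayScalar c
  rw [h1, h2, ha'.eval₂_mul_left]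
  have h3 : a.eval₂ ((algebraMap (MvPolynomial (Fin (N + 1)) K) (Localization.Away ℓ₀)).comp
      MvPolynomial.C) (fun k =>
        algebraMap (MvPolynomial (Fin (N + 1)) K) (Localization.Away ℓ₀) (MvPolynomial.X k)) =
      algebraMap _ (Localization.Away ℓ₀) a := by
    have := MvPolynomial.hom_eval₂ a MvPolynomial.C
      (algebraMap (MvPolynomial (Fin (N + 1)) K) (Localization.Away ℓ₀)) MvPolynomial.X
    rw [MvPolynomial.eval₂_eta] at this
    exact this.symm
  rw [h3, Away.val_mk, Localization.mk_eq_mk', IsLocalization.eq_mk'_iff_mul_eq, mul_right_comm,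
    map_pow, ← mul_pow, mul_comm (IsLocalization.Away.invSelf ℓ₀),
    IsLocalization.Away.mul_invSelf, one_pow, one_mul]

variable {B : Type u} [CommRing B] [Algebra K B]

/-- The affine coordinates on a chart, as a linear map on the space of linear forms. -/
noncomputable def affineCoord (h₀ : ℓ₀ ∈ grading K N 1) (ψ : Away (grading K N) ℓ₀ →+* B)
    (hψ : ψ.comp (awayScalar K N ℓ₀) = algebraMap K B) : grading K N 1 →ₗ[K] B where
  toFun ℓ := ψ (formRatio h₀ ℓ)
  map_add' a b := by rw [formRatio_add, map_add]
  map_smul' c a := by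
    rw [formRatio_smul, map_mul, ← RingHom.comp_apply, hψ, RingHom.id_apply, Algebra.smul_def]

theorem adjoin_range_affineCoord (h₀ : ℓ₀ ∈ grading K N 1) (ψ : Away (grading K N) ℓ₀ →+* B)
    (hψ : ψ.comp (awayScalar K N ℓ₀) = algebraMap K B) (hsurj : Function.Surjective ψ) :
    Algebra.adjoin K (Set.range (affineCoord h₀ ψ hψ)) = ⊤ := by
  rw [eq_top_iff]
  rintro b -
  obtain ⟨x, rfl⟩ := hsurj b
  obtain ⟨p, rfl⟩ := eval₂Hom_formRatio_surjective h₀ x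
  induction p using MvPolynomial.induction_on with
  | C c =>
    rw [MvPolynomial.eval₂Hom_C, ← RingHom.comp_apply, hψ]
    exact Subalgebra.algebraMap_mem _ c
  | add p q hp hq => rw [map_add, map_add]; exact add_mem hp hq
  | mul_X p k hp =>
    rw [map_mul, map_mul, MvPolynomial.eval₂Hom_X']
    exact mul_mem hp (Algebra.subset_adjoin ⟨coordForm K N k, rfl⟩)

theorem finiteType_of_surjective (h₀ : ℓ₀ ∈ grading K N 1) (ψ : Away (grading K N) ℓ₀ →+* B)
    (hψ : ψ.comp (awayScalar K N ℓ₀) = algebraMap K B) (hsurj : Function.Surjective ψ) :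
    Algebra.FiniteType K B := by
  let F : MvPolynomial (Fin (N + 1)) K →ₐ[K] B :=
    { ψ.comp (MvPolynomial.eval₂Hom (awayScalar K N ℓ₀) fun k => formRatio h₀ (coordForm K N k)) with
      commutes' := fun c => by
        simp only [RingHom.toMonoidHom_eq_coe, OneHom.toFun_eq_coe, MonoidHom.toOneHom_coe,
          MonoidHom.coe_coe, MvPolynomial.algebraMap_eq, RingHom.comp_apply,
          MvPolynomial.eval₂Hom_C, ← hψ] }
  exact Algebra.FiniteType.of_surjective F
    (hsurj.comp (eval₂Hom_formRatio_surjective h₀))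

theorem coordForm_mem (K : Type u) [Field K] (N : ℕ) (k : Fin (N + 1)) :
    (MvPolynomial.X k : MvPolynomial (Fin (N + 1)) K) ∈ grading K N 1 :=
  MvPolynomial.isHomogeneous_X K k

/-- The coordinate ring of the standard chart of the plane, presented by the polynomial ring. -/
noncomputable def planeChart (K : Type u) [Field K] :
    K[X][X] →+* Away (grading K 2) (MvPolynomial.X 0) :=
  Polynomial.eval₂RingHom (Polynomial.eval₂RingHom (awayScalar K 2 (MvPolynomial.X 0))
    (formRatio (coordForm_mem K 2 0) (coordForm K 2 1)))
    (formRatio (coordForm_mem K 2 0) (coordForm K 2 2))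

theorem planeChart_surjective : Function.Surjective (planeChart K) := by
  intro x
  obtain ⟨p, rfl⟩ := eval₂Hom_formRatio_surjective (coordForm_mem K 2 0) x
  rw [← RingHom.mem_range]
  induction p using MvPolynomial.induction_on with
  | C c => exact ⟨Polynomial.C (Polynomial.C c), by simp [planeChart]⟩
  | add p q hp hq => rw [map_add]; exact add_mem hp hq
  | mul_X p k hp =>
    rw [map_mul, MvPolynomial.eval₂Hom_X']
    refine mul_mem hp ?_
    fin_cases k
    · exact (formRatio_self (coordForm_mem K 2 0)).symm ▸ one_mem _
    · exact ⟨Polynomial.C Polynomial.X, by simp [planeChart]⟩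
    · exact ⟨Polynomial.X, by simp [planeChart]⟩

/-- The graded homomorphism with prescribed images of the coordinates. -/
noncomputable def linearSubst {M : ℕ} (ℓ : Fin (M + 1) → grading K N 1) :
    GradedRingHom (grading K M) (grading K N) where
  __ := (MvPolynomial.aeval (fun j => (ℓ j : MvPolynomial (Fin (N + 1)) K))).toRingHom
  map_mem {n x} hx := by
    have := MvPolynomial.IsHomogeneous.aeval (n := 1) hx
      (fun j => (ℓ j : MvPolynomial (Fin (N + 1)) K)) (fun j => (ℓ j).2)
    rw [one_mul] at this
    exact this

theorem linearSubst_X {M : ℕ} (ℓ : Fin (M + 1) → grading K N 1) (j : Fin (M + 1)) :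
    linearSubst ℓ (MvPolynomial.X j) = ℓ j :=
  MvPolynomial.aeval_X _ j

theorem linearSubst_C {M : ℕ} (ℓ : Fin (M + 1) → grading K N 1) (c : K) :
    linearSubst ℓ (MvPolynomial.C c) = MvPolynomial.C c :=
  MvPolynomial.aeval_C _ c

theorem awayScalar_eq_mk (h₀ : ℓ₀ ∈ grading K N 1) (c : K) :
    awayScalar K N ℓ₀ c = Away.mk (grading K N) h₀ 0 (MvPolynomial.C c)
      (by simp) := by
  apply HomogeneousLocalization.val_injective
  rw [val_awayScalar, Away.val_mk, ← Localization.mk_one_eq_algebraMap]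
  congr 1

theorem map_awayScalar {M : ℕ} (φ : GradedRingHom (grading K M) (grading K N))
    (hφ : ∀ c : K, φ (MvPolynomial.C c) = MvPolynomial.C c) {s : MvPolynomial (Fin (M + 1)) K}
    (hs : s ∈ grading K M 1) :
    (Away.map φ s).comp (awayScalar K M s) = awayScalar K N (φ s) := by
  refine RingHom.ext fun c => ?_
  rw [RingHom.comp_apply, awayScalar_eq_mk hs, awayScalar_eq_mk (Graded.map_mem φ hs),
    Away.map_mk]
  simp only [hφ]

theorem map_formRatio {M : ℕ} (φ : GradedRingHom (grading K M) (grading K N))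
    {s : MvPolynomial (Fin (M + 1)) K} (hs : s ∈ grading K M 1) (ℓ : grading K M 1) :
    Away.map φ s (formRatio hs ℓ) =
      formRatio (Graded.map_mem φ hs) ⟨φ ℓ, Graded.map_mem φ ℓ.2⟩ := by
  rw [formRatio, Away.map_mk]
  rfl

end LinearForms

/-! ### Finiteness of linear projections and affine charts -/

section Projection

open HomogeneousLocalization ProjectiveVariety

variable {K : Type u} [Field K] {N : ℕ}

theorem algebraMap_grading_zero_surjective :
    Function.Surjective (algebraMap K (grading K N 0)) := by
  rintro ⟨x, hx⟩
  rw [grading, MvPolynomial.homogeneousSubmodule_zero] at hx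
  obtain ⟨c, hc⟩ := Submodule.mem_one.mp hx
  exact ⟨c, Subtype.ext hc⟩

theorem adjoin_range_X : Algebra.adjoin (grading K N 0)
    (Set.range (MvPolynomial.X : Fin (N + 1) → MvPolynomial (Fin (N + 1)) K)) = ⊤ := by
  rw [eq_top_iff]
  rintro p -
  induction p using MvPolynomial.induction_on with
  | C c => exact Subalgebra.algebraMap_mem _ (algebraMap K (grading K N 0) c)
  | add p q hp hq => exact add_mem hp hq
  | mul_X p k hp => exact mul_mem hp (Algebra.subset_adjoin ⟨k, rfl⟩)

instance isProper_projSpaceStr : IsProper (projSpaceStr K N) := by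
  have : IsClosedImmersion (Spec.map (CommRingCat.ofHom (algebraMap K (grading K N 0)))) :=
    IsClosedImmersion.spec_of_surjective _ algebraMap_grading_zero_surjective
  have : Algebra.FiniteType (grading K N 0) (MvPolynomial (Fin (N + 1)) K) := by
    classical
    exact ⟨⟨Finset.univ.image MvPolynomial.X, by simpa using adjoin_range_X⟩⟩
  rw [projSpaceStr]
  infer_instance

theorem awayι_projSpaceStr {ℓ₀ : MvPolynomial (Fin (N + 1)) K} (h₀ : ℓ₀ ∈ grading K N 1) :
    Proj.awayι (grading K N) ℓ₀ h₀ one_pos ≫ projSpaceStr K N =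
      Spec.map (CommRingCat.ofHom (awayScalar K N ℓ₀)) := by
  rw [projSpaceStr, Proj.awayι_toSpecZero_assoc, ← Spec.map_comp, ← CommRingCat.ofHom_comp]
  rfl

variable {X : Scheme.{u}} (i : X ⟶ projSpace K N)

/-- A linear projection whose centre does not meet a projective variety is a finite morphism. -/
theorem exists_finite_linearSubst [IsClosedImmersion i] {M : ℕ} (ℓ : Fin (M + 1) → grading K N 1)
    (hcov : ∀ x : X, ∃ j, i x ∈ Proj.basicOpen (grading K N) (ℓ j : MvPolynomial (Fin (N + 1)) K)) :
    ∃ g : X ⟶ projSpace K M, g ≫ projSpaceStr K M = i ≫ projSpaceStr K N ∧ IsFinite g ∧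
      (∀ j, g ⁻¹ᵁ Proj.basicOpen (grading K M) (MvPolynomial.X j) =
        i ⁻¹ᵁ Proj.basicOpen (grading K N) (ℓ j : MvPolynomial (Fin (N + 1)) K)) ∧
      ∀ j, (i ⁻¹ᵁ Proj.basicOpen (grading K N) (linearSubst ℓ (MvPolynomial.X j))).ι ≫ g =
        projChart (linearSubst ℓ) i (MvPolynomial.X j) (coordForm_mem K M j) one_pos := by
  let φ := linearSubst ℓ
  let t : ULift.{u} (Fin (M + 1)) → MvPolynomial (Fin (M + 1)) K := fun j => MvPolynomial.X j.down
  have ht (j) : t j ∈ grading K M 1 := coordForm_mem K M j.down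
  have hφt (j) : φ (t j) = ℓ j.down := linearSubst_X ℓ j.down
  have hcov' (x : X) : ∃ j, i x ∈ Proj.basicOpen (grading K N) (φ (t j)) := by
    obtain ⟨j, hj⟩ := hcov x
    exact ⟨⟨j⟩, by rwa [hφt]⟩
  obtain ⟨g, hg⟩ := exists_glue_projChart φ i t ht (fun _ => one_pos) hcov'
  have hstr : g ≫ projSpaceStr K M = i ≫ projSpaceStr K N := by
    refine comp_eq_of_projChart φ i t ht (fun _ => one_pos) hcov' hg _ _ fun j => ?_
    rw [awayι_projSpaceStr (ht j), awayι_projSpaceStr (Graded.map_mem φ (ht j)),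
      ← Spec.map_comp, ← CommRingCat.ofHom_comp, map_awayScalar φ (linearSubst_C ℓ) (ht j)]
  have hpre (j : Fin (M + 1)) : g ⁻¹ᵁ Proj.basicOpen (grading K M) (MvPolynomial.X j) =
      i ⁻¹ᵁ Proj.basicOpen (grading K N) (φ (MvPolynomial.X j)) :=
    preimage_basicOpen_of_projChart φ i t ht (fun _ => one_pos) hcov' hg
      (coordForm_mem K M j) one_pos
  have hcover : ⨆ j : Fin (M + 1), Proj.basicOpen (grading K M) (MvPolynomial.X j) = ⊤ := by
    exact Proj.iSup_basicOpen_eq_top' _ _ (fun j => ⟨1, coordForm_mem K M j⟩) adjoin_range_X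
  -- The preimages of the standard charts are closed in affine charts of the source space. Being
  -- both affine and proper, g is finite.
  have haff : IsAffineHom g := by
    refine isAffineHom_of_forall_exists_isAffineOpen _ fun x => ?_
    obtain ⟨j, hj⟩ := TopologicalSpace.Opens.mem_iSup.mp (hcover.ge (Set.mem_univ x))
    refine ⟨_, hj, Proj.isAffineOpen_basicOpen _ _ (coordForm_mem K M j) one_pos, ?_⟩
    rw [hpre]
    exact (Proj.isAffineOpen_basicOpen _ _ (Graded.map_mem φ (coordForm_mem K M j)) one_pos).preimage i
  have hprop : IsProper g := by
    have : IsProper (g ≫ projSpaceStr K M) := by rw [hstr]; infer_instance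
    exact IsProper.of_comp g (projSpaceStr K M)
  refine ⟨g, hstr, IsFinite.iff_isProper_and_isAffineHom.mpr ⟨hprop, haff⟩, fun j => ?_,
    fun j => hg ⟨j⟩⟩
  rw [hpre]
  exact congr(i ⁻¹ᵁ Proj.basicOpen (grading K N) $(linearSubst_X ℓ j))

/-- The affine chart `ℓ₀ ≠ 0` of a closed subscheme of projective space. -/
theorem exists_affine_chart [IsClosedImmersion i] {ℓ₀ : MvPolynomial (Fin (N + 1)) K}
    (h₀ : ℓ₀ ∈ grading K N 1) :
    ∃ (B : Type u) (_ : CommRing B) (ψ : Away (grading K N) ℓ₀ →+* B)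
      (e : Spec (.of B) ⟶ X) (_ : IsOpenImmersion e), Function.Surjective ψ ∧
      e.opensRange = i ⁻¹ᵁ Proj.basicOpen (grading K N) ℓ₀ ∧
      e ≫ i = Spec.map (CommRingCat.ofHom ψ) ≫ Proj.awayι (grading K N) ℓ₀ h₀ one_pos := by
  let a := Proj.awayι (grading K N) ℓ₀ h₀ one_pos
  obtain ⟨I, iso, hiso⟩ := IsClosedImmersion.Spec_iff.mp
    (inferInstance : IsClosedImmersion (Limits.pullback.snd i a))
  refine ⟨_ ⧸ I, inferInstance, Ideal.Quotient.mk I, iso.inv ≫ Limits.pullback.fst i a,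
    inferInstance, Ideal.Quotient.mk_surjective, ?_, ?_⟩
  · rw [Scheme.Hom.opensRange_comp_of_isIso]
    ext1
    rw [Scheme.Hom.coe_opensRange, IsOpenImmersion.range_pullbackFst]
    exact congr(i ⁻¹' ($(Proj.opensRange_awayι (grading K N) ℓ₀ h₀ one_pos) : (Proj (grading K N)).Opens))
  · rw [Category.assoc, Limits.pullback.condition, hiso, Category.assoc, Iso.inv_hom_id_assoc]

/-- Both maps from the chart factor through the open subset where φ s is invertible, where g is
given by its defining formula. -/
theorem comp_eq_SpecMap_awayι {M : ℕ} (φ : GradedRingHom (grading K M) (grading K N))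
    {s : MvPolynomial (Fin (M + 1)) K} (hs : s ∈ grading K M 1) {g : X ⟶ projSpace K M}
    (hg : (i ⁻¹ᵁ Proj.basicOpen (grading K N) (φ s)).ι ≫ g = projChart φ i s hs one_pos)
    {B : Type u} [CommRing B] (ψ : Away (grading K N) (φ s) →+* B) (e : Spec (.of B) ⟶ X)
    (he : e ≫ i = Spec.map (CommRingCat.ofHom ψ) ≫
      Proj.awayι (grading K N) (φ s) (Graded.map_mem φ hs) one_pos) :
    e ≫ g = Spec.map (CommRingCat.ofHom (ψ.comp (Away.map φ s))) ≫
      Proj.awayι (grading K M) s hs one_pos := by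
  let U := i ⁻¹ᵁ Proj.basicOpen (grading K N) (φ s)
  have hrange : Set.range e ⊆ Set.range U.ι := by
    rintro _ ⟨x, rfl⟩
    rw [Scheme.Opens.range_ι]
    change i (e x) ∈ Proj.basicOpen (grading K N) (φ s)
    rw [← Scheme.Hom.comp_apply, he, Scheme.Hom.comp_apply,
      ← Proj.opensRange_awayι (grading K N) (φ s) (Graded.map_mem φ hs) one_pos]
    exact ⟨_, rfl⟩
  let e' := IsOpenImmersion.lift U.ι e hrange
  have he' : e' ≫ U.ι = e := IsOpenImmersion.lift_fac _ _ _
  have h1 : e' ≫ i ∣_ Proj.basicOpen (grading K N) (φ s) ≫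
      Proj.basicOpenToSpec (grading K N) (φ s) = Spec.map (CommRingCat.ofHom ψ) := by
    rw [← cancel_mono (Proj.awayι (grading K N) (φ s) (Graded.map_mem φ hs) one_pos), ← he]
    simp only [Category.assoc]
    rw [basicOpenToSpec_awayι, morphismRestrict_ι, ← Category.assoc, he']
  rw [← he', Category.assoc, hg, projChart, CommRingCat.ofHom_comp, Spec.map_comp, ← h1]
  simp only [Category.assoc]

end Projection

/-! ### A linear projection in affine coordinates -/

section Chart

open HomogeneousLocalization ProjectiveVariety

variable {K : Type u} [Field K] {N : ℕ} {X : Scheme.{u}} (i : X ⟶ projSpace K N)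
  {B : Type u} [CommRing B] [Algebra K B]

/-- In affine coordinates, a linear projection is the evaluation of polynomials at quotients of
linear forms. -/
theorem exists_chart_planeHom (φ : GradedRingHom (grading K 2) (grading K N))
    (hφ : ∀ c : K, φ (MvPolynomial.C c) = MvPolynomial.C c) (ℓ : Fin 3 → grading K N 1)
    (hℓ : ∀ j : Fin 3, φ (MvPolynomial.X j) = ℓ j) {g : X ⟶ projSpace K 2}
    (hg : (i ⁻¹ᵁ Proj.basicOpen (grading K N) (φ (MvPolynomial.X 0))).ι ≫ g =
      projChart φ i (MvPolynomial.X 0) (coordForm_mem K 2 0) one_pos)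
    {ℓ₀ : MvPolynomial (Fin (N + 1)) K} (h₀ : ℓ₀ ∈ grading K N 1) (hℓ₀ : ℓ 0 = ⟨ℓ₀, h₀⟩)
    (ψ : Away (grading K N) ℓ₀ →+* B) (hψ : ψ.comp (awayScalar K N ℓ₀) = algebraMap K B)
    (e : Spec (.of B) ⟶ X) (he : e ≫ i = Spec.map (CommRingCat.ofHom ψ) ≫
      Proj.awayι (grading K N) ℓ₀ h₀ one_pos) :
    ∃ θ : Away (grading K 2) (MvPolynomial.X 0) →+* B,
      e ≫ g = Spec.map (CommRingCat.ofHom θ) ≫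
        Proj.awayι (grading K 2) (MvPolynomial.X 0) (coordForm_mem K 2 0) one_pos ∧
      θ.comp (planeChart K) =
        planeHom K (affineCoord h₀ ψ hψ (ℓ 1)) (affineCoord h₀ ψ hψ (ℓ 2)) := by
  have h : φ (MvPolynomial.X 0) = ℓ₀ := by rw [hℓ, hℓ₀]
  subst h
  refine ⟨ψ.comp (Away.map φ (MvPolynomial.X 0)),
    comp_eq_SpecMap_awayι i φ (coordForm_mem K 2 0) hg ψ e he, ?_⟩
  have hr (k : Fin 3) : (⟨φ (coordForm K 2 k), Graded.map_mem φ (coordForm K 2 k).2⟩ :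
      grading K N 1) = ℓ k := Subtype.ext (hℓ k)
  refine Polynomial.ringHom_ext' (Polynomial.ringHom_ext' ?_ ?_) ?_
  · refine RingHom.ext fun c => ?_
    have h1 := RingHom.congr_fun (map_awayScalar φ hφ (coordForm_mem K 2 0)) c
    have h2 := RingHom.congr_fun hψ c
    simp only [RingHom.comp_apply] at h1 h2
    simp only [RingHom.comp_apply, planeHom_C, planeChart, Polynomial.coe_eval₂RingHom,
      Polynomial.eval₂_C, Polynomial.aeval_C, h1, h2]
  · simp only [RingHom.comp_apply, planeHom_C, planeChart, Polynomial.coe_eval₂RingHom,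
      Polynomial.eval₂_C, Polynomial.eval₂_X, Polynomial.aeval_X, map_formRatio, hr]
    rfl
  · simp only [RingHom.comp_apply, planeHom_X, planeChart, Polynomial.coe_eval₂RingHom,
      Polynomial.eval₂_X, map_formRatio, hr]
    rfl

variable {Y : Scheme.{u}} {A : Type u} [CommRing A]

-- The chart is the full preimage of the target chart, so the ring map is a base change of g.
omit [Algebra K B] in
theorem isIntegral_of_isFinite_chart {g : X ⟶ Y} [IsFinite g] (e : Spec (.of B) ⟶ X)
    [IsOpenImmersion e] (a : Spec (.of A) ⟶ Y) [IsOpenImmersion a] {θ : A →+* B}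
    (h : e ≫ g = Spec.map (CommRingCat.ofHom θ) ≫ a) (hpre : g ⁻¹ᵁ a.opensRange = e.opensRange) :
    θ.IsIntegral := by
  have hpb := IsOpenImmersion.isPullback (Spec.map (CommRingCat.ofHom θ)) e a g h hpre
  have : IsIntegralHom (Spec.map (CommRingCat.ofHom θ)) :=
    MorphismProperty.of_isPullback (P := @IsIntegralHom) hpb.flip inferInstance
  exact IsIntegralHom.SpecMap_iff.mp this

omit [Algebra K B] in
theorem isEtaleAt_of_chart {g : X ⟶ Y} (e : Spec (.of B) ⟶ X)
    [IsOpenImmersion e] (a : Spec (.of A) ⟶ Y) [IsOpenImmersion a] {θ : A →+* B}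
    (h : e ≫ g = Spec.map (CommRingCat.ofHom θ) ≫ a) (y : PrimeSpectrum B) {f : B}
    (hf : f ∉ y.asIdeal) (het : ((algebraMap B (Localization.Away f)).comp θ).Etale) :
    IsEtaleAt g (e y) := by
  let l : Spec (.of (Localization.Away f)) ⟶ Spec (.of B) :=
    Spec.map (CommRingCat.ofHom (algebraMap B (Localization.Away f)))
  have hl : IsOpenImmersion l := IsOpenImmersion.of_isLocalization (R := CommRingCat.of B) f
  have hy : y ∈ Set.range l := by
    have := PrimeSpectrum.localization_away_comap_range (Localization.Away f) f
    exact this ▸ hf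
  refine ⟨(l ≫ e).opensRange, ?_, ?_⟩
  · obtain ⟨z, rfl⟩ := hy
    exact ⟨z, by simp⟩
  · have h1 : (l ≫ e).opensRange.ι = (l ≫ e).isoOpensRange.inv ≫ l ≫ e := by
      rw [Iso.eq_inv_comp, Scheme.Hom.isoOpensRange_hom_ι]
    have h2 : Etale (Spec.map (CommRingCat.ofHom ((algebraMap B (Localization.Away f)).comp θ))) :=
      (HasRingHomProperty.Spec_iff (P := @Etale)).mpr het
    rw [h1, Category.assoc, Category.assoc, h]
    simp only [l]
    rw [← Spec.map_comp_assoc, ← CommRingCat.ofHom_comp]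
    infer_instance

/-- An injective map factoring through the presentation of the chart forces the presentation to be
injective, so the target chart is the affine plane. -/
theorem planeChart_bijective_of_injective {θ : Away (grading K 2) (MvPolynomial.X 0) →+* B}
    {a₁ a₂ : B} (h : θ.comp (planeChart K) = planeHom K a₁ a₂)
    (hinj : Function.Injective (planeHom K a₁ a₂)) : Function.Bijective (planeChart K) := by
  refine ⟨?_, planeChart_surjective⟩
  rw [← h, RingHom.coe_comp] at hinj
  exact hinj.of_comp

theorem etale_of_planeHom {C : Type u} [CommRing C] (m : B →+* C)
    {θ : Away (grading K 2) (MvPolynomial.X 0) →+* B}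
    {a₁ a₂ : B} (h : θ.comp (planeChart K) = planeHom K a₁ a₂)
    (hinj : Function.Injective (planeHom K a₁ a₂)) (het : (m.comp (planeHom K a₁ a₂)).Etale) :
    (m.comp θ).Etale := by
  let E := RingEquiv.ofBijective (planeChart K) (planeChart_bijective_of_injective h hinj)
  have : m.comp θ = (m.comp (planeHom K a₁ a₂)).comp E.symm.toRingHom := by
    rw [← h]
    refine RingHom.ext fun x => ?_
    simp only [RingHom.comp_apply]
    congr 2
    exact (E.apply_symm_apply x).symm
  rw [this]
  exact RingHom.Etale.respectsIso.2 _ _ het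

/-- Since ℓ₀/ℓ₀ = 1, a linear relation among the forms becomes c₀ + c₁a₁ + c₂a₂ = 0, a polynomial in
the kernel. -/
theorem linearIndependent_of_planeHom_injective (ℓ : Fin 3 → grading K N 1)
    {ℓ₀ : MvPolynomial (Fin (N + 1)) K} (h₀ : ℓ₀ ∈ grading K N 1) (hℓ₀ : ℓ 0 = ⟨ℓ₀, h₀⟩)
    (ψ : Away (grading K N) ℓ₀ →+* B) (hψ : ψ.comp (awayScalar K N ℓ₀) = algebraMap K B)
    (hinj : Function.Injective
      (planeHom K (affineCoord h₀ ψ hψ (ℓ 1)) (affineCoord h₀ ψ hψ (ℓ 2)))) :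
    LinearIndependent K ℓ := by
  rw [Fintype.linearIndependent_iff]
  intro c hc
  have h1 := congr(affineCoord h₀ ψ hψ $hc)
  have h2 : affineCoord h₀ ψ hψ (ℓ 0) = 1 := by
    rw [hℓ₀]
    change ψ (formRatio h₀ _) = 1
    rw [formRatio_self, map_one]
  rw [map_sum, Fin.sum_univ_three, map_zero, map_smul, map_smul, map_smul, h2] at h1
  let H : K[X][X] := Polynomial.C (Polynomial.C (c 0) + Polynomial.C (c 1) * Polynomial.X) +
    Polynomial.C (Polynomial.C (c 2)) * Polynomial.X
  have hH : H = 0 := by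
    apply hinj
    rw [map_zero, ← h1]
    simp only [H, map_add, map_mul, planeHom_X, planeHom_C, Polynomial.aeval_C,
      Polynomial.aeval_X, Algebra.smul_def, mul_one]
  have e0 := congr((Polynomial.coeff $hH 0).coeff 0)
  have e1 := congr((Polynomial.coeff $hH 0).coeff 1)
  have e2 := congr((Polynomial.coeff $hH 1).coeff 0)
  simp [H, Polynomial.coeff_C] at e0 e1 e2
  intro j
  fin_cases j
  · exact e0
  · exact e1
  · exact e2

end Chart

/-! ### Chains of specializations and dimension -/

section Chains

open TopologicalSpace

/-- The length of a chain of specializations is bounded by the dimension. -/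
theorem le_topologicalKrullDim_of_specializes {X : Type*} [TopologicalSpace X] [T0Space X] {n : ℕ}
    (x : Fin (n + 1) → X) (h : ∀ k : Fin n, x k.succ ⤳ x k.castSucc)
    (hne : ∀ k : Fin n, x k.succ ≠ x k.castSucc) : n ≤ topologicalKrullDim X := by
  let c (k : Fin (n + 1)) : IrreducibleCloseds X :=
    ⟨closure {x k}, isIrreducible_singleton.closure, isClosed_closure⟩
  let s : LTSeries (IrreducibleCloseds X) :=
    { length := n
      toFun := c
      step := fun k => by
        refine lt_of_le_of_ne (specializes_iff_closure_subset.mp (h k)) fun heq => hne k ?_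
        exact (inseparable_iff_closure_eq.mpr congr(($heq : Set X))).eq.symm }
  exact Order.LTSeries.length_le_krullDim s

theorem not_chain_of_topologicalKrullDim_eq_two {X : Type*} [TopologicalSpace X] [T0Space X]
    (hdim : topologicalKrullDim X = 2) {a b c d : X} (hab : a ⤳ b) (hbc : b ⤳ c) (hcd : c ⤳ d)
    (hab' : a ≠ b) (hbc' : b ≠ c) : c = d := by
  by_contra hcd'
  -- The chain is listed from the most special point upwards, so that closures increase.
  have := le_topologicalKrullDim_of_specializes (n := 3) ![d, c, b, a]
    (by intro k; fin_cases k <;> assumption) (by intro k; fin_cases k <;> assumption)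
  rw [hdim] at this
  exact absurd this (by decide)

/-- A closed subset of a Noetherian sober space has finitely many generic points. -/
theorem exists_finite_generic_points {X : Type*} [TopologicalSpace X] [NoetherianSpace X]
    [QuasiSober X] {Z : Set X} (hZ : IsClosed Z) :
    ∃ T : Set X, T.Finite ∧ T ⊆ Z ∧ ∀ z ∈ Z, ∃ t ∈ T, t ⤳ z := by
  obtain ⟨S, hS, hc, hi, rfl⟩ := NoetherianSpace.exists_finite_set_isClosed_irreducible hZ
  choose p hp using fun t : S => QuasiSober.sober (hi t t.2) (hc t t.2)
  have := hS.to_subtype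
  refine ⟨Set.range p, Set.finite_range p, ?_, ?_⟩
  · rintro _ ⟨t, rfl⟩
    exact ⟨t, t.2, (hp t).mem⟩
  · rintro z ⟨t, ht, hzt⟩
    exact ⟨p ⟨t, ht⟩, ⟨_, rfl⟩, (hp ⟨t, ht⟩).specializes hzt⟩

end Chains

/-! ### Generic linear forms without common zero on a surface -/

section Generic

open ProjectiveVariety

variable {K : Type u} [Field K] {N : ℕ}

theorem iSup_basicOpen_X : ⨆ j : Fin (N + 1), Proj.basicOpen (grading K N) (MvPolynomial.X j) = ⊤ :=
  Proj.iSup_basicOpen_eq_top' _ _ (fun j => ⟨1, coordForm_mem K N j⟩) adjoin_range_X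

/-- A generic linear form does not vanish at a given point. -/
theorem generic_mem_basicOpen (x : projSpace K N) :
    GenericProp K (fun ℓ : grading K N 1 =>
      x ∈ Proj.basicOpen (grading K N) (ℓ : MvPolynomial (Fin (N + 1)) K)) := by
  let S : Submodule K (grading K N 1) :=
    (x.asHomogeneousIdeal.toIdeal.restrictScalars K).comap (grading K N 1).subtype
  have hS : S ≠ ⊤ := by
    intro htop
    obtain ⟨j, hj⟩ := TopologicalSpace.Opens.mem_iSup.mp (iSup_basicOpen_X.ge (Set.mem_univ x))
    have : coordForm K N j ∈ S := htop ▸ Submodule.mem_top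
    exact hj this
  exact GenericProp.notMem hS

variable {X : Scheme.{u}} (i : X ⟶ projSpace K N)

theorem noetherianSpace_of_isClosedImmersion [IsClosedImmersion i] :
    TopologicalSpace.NoetherianSpace X := by
  have : IsLocallyNoetherian X :=
    LocallyOfFiniteType.isLocallyNoetherian (i ≫ projSpaceStr K N)
  have : CompactSpace X := by
    rw [← quasiCompact_iff_compactSpace (i ≫ projSpaceStr K N)]
    infer_instance
  have : IsNoetherian X := {}
  infer_instance

/-- Two generic linear forms complete a nonzero linear form to a linear projection of a surface
whose centre does not meet the surface. -/
theorem generic_cover [IsClosedImmersion i] [IsIntegral X] (hdim : topologicalKrullDim X = 2)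
    (ℓ₀ : grading K N 1)
    (hne : ∃ x, i x ∈ Proj.basicOpen (grading K N) (ℓ₀ : MvPolynomial (Fin (N + 1)) K)) :
    GenericProp K fun ℓ₁ : grading K N 1 => GenericProp K fun ℓ₂ : grading K N 1 =>
      ∀ x : X, ∃ j : Fin 3, i x ∈ Proj.basicOpen (grading K N)
        (![ℓ₀, ℓ₁, ℓ₂] j : MvPolynomial (Fin (N + 1)) K) := by
  have := noetherianSpace_of_isClosedImmersion i
  let U (ℓ : grading K N 1) : X.Opens :=
    i ⁻¹ᵁ Proj.basicOpen (grading K N) (ℓ : MvPolynomial (Fin (N + 1)) K)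
  obtain ⟨T₀, hT₀, hTU₀, hsp₀⟩ := exists_finite_generic_points (U ℓ₀).isOpen.isClosed_compl
  refine (GenericProp.forall_mem hT₀ fun t _ => generic_mem_basicOpen (i t)).mono
    fun ℓ₁ h₁ => ?_
  obtain ⟨T₁, hT₁, hTU₁, hsp₁⟩ := exists_finite_generic_points
    ((U ℓ₀).isOpen.isClosed_compl.inter (U ℓ₁).isOpen.isClosed_compl)
  refine (GenericProp.forall_mem hT₁ fun t _ => generic_mem_basicOpen (i t)).mono
    fun ℓ₂ h₂ x => ?_
  by_contra! hx
  obtain ⟨t₁, ht₁, hs₁⟩ := hsp₁ x ⟨hx 0, hx 1⟩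
  obtain ⟨t₀, ht₀, hs₀⟩ := hsp₀ t₁ (hTU₁ ht₁).1
  have hη : genericPoint X ∈ U ℓ₀ := by
    obtain ⟨z, hz⟩ := hne
    exact (genericPoint_specializes z).mem_open (U ℓ₀).isOpen hz
  -- Generic point, t₀ on ℓ₀ = 0, t₁ on ℓ₀ = ℓ₁ = 0: the first two specializations are strict, so in
  -- dimension two x must be t₁, where ℓ₂ was chosen nonzero.
  have h := not_chain_of_topologicalKrullDim_eq_two hdim (genericPoint_specializes t₀) hs₀ hs₁
    (fun h => hTU₀ ht₀ (h ▸ hη)) (fun h => (hTU₁ ht₁).2 (h ▸ h₁ t₀ ht₀))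
  exact hx 2 (h ▸ h₂ t₁ ht₁)

end Generic

/-! ### Points, chains and smoothness on an affine chart -/

section ChartPoints

variable {X : Scheme.{u}} {B : Type u} [CommRing B] (e : Spec (.of B) ⟶ X) [IsOpenImmersion e]

theorem le_iff_specializes_chart (y z : PrimeSpectrum B) :
    y.asIdeal ≤ z.asIdeal ↔ e y ⤳ e z :=
  (PrimeSpectrum.le_iff_specializes y z).trans
    (e.isOpenEmbedding.isInducing.specializes_iff (x := y) (y := z)).symm

theorem isMaximal_of_isClosed_chart (y : PrimeSpectrum B) (hy : IsClosed {e y}) :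
    y.asIdeal.IsMaximal := by
  rw [← PrimeSpectrum.isClosed_singleton_iff_isMaximal]
  have h : e ⁻¹' {e y} = {y} := Set.ext fun z =>
    ⟨fun h => e.isOpenEmbedding.injective h, fun h => congrArg e h⟩
  exact h ▸ hy.preimage e.continuous

include e in
theorem isDomain_chart [IsIntegral X] [Nonempty (PrimeSpectrum B)] : IsDomain B := by
  have : Nonempty (Spec (.of B)) := ‹Nonempty (PrimeSpectrum B)›
  have := isIntegral_of_isOpenImmersion e
  exact (affine_isIntegral_iff (.of B)).mp this

include e in
theorem not_chain_chart [IsDomain B] (hdim : topologicalKrullDim X = 2) (p q r : Ideal B)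
    (hp : p.IsPrime) (hq : q.IsPrime) (hr : r.IsPrime) (h0 : ⊥ < p) (hpq : p < q) : ¬ q < r := by
  intro hqr
  have key {a b : PrimeSpectrum B} (h : a.asIdeal < b.asIdeal) : e a ⤳ e b ∧ e a ≠ e b :=
    ⟨(le_iff_specializes_chart e a b).mp h.le, fun hab =>
      h.ne congr(($(e.isOpenEmbedding.injective hab) : PrimeSpectrum B).asIdeal)⟩
  have h1 := key (a := ⟨⊥, Ideal.isPrime_bot⟩) (b := ⟨p, hp⟩) h0
  have h2 := key (a := ⟨p, hp⟩) (b := ⟨q, hq⟩) hpq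
  have h3 := key (a := ⟨q, hq⟩) (b := ⟨r, hr⟩) hqr
  exact h3.2 (not_chain_of_topologicalKrullDim_eq_two hdim h1.1 h2.1 h3.1 h1.2 h2.2)

/-- The local ring at a point of the smooth locus is formally smooth. -/
theorem formallySmooth_chart {K : Type u} [Field K] [Algebra K B] [Algebra.FiniteType K B]
    (V : X.Opens) (s : X ⟶ Spec (.of K)) (hs : e ≫ s = Spec.map (CommRingCat.ofHom (algebraMap K B)))
    (hV : Smooth (V.ι ≫ s)) (c : PrimeSpectrum B) (hc : e c ∈ V) :
    Algebra.FormallySmooth K (Localization.AtPrime c.asIdeal) := by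
  have : Algebra.FinitePresentation K B := Algebra.FinitePresentation.of_finiteType.mp inferInstance
  obtain ⟨_, ⟨b, rfl⟩, hcb, hbV⟩ := PrimeSpectrum.isTopologicalBasis_basic_opens.exists_subset_of_mem_open
    (show c ∈ e ⁻¹' V from hc) (V.isOpen.preimage e.continuous)
  let l : Spec (.of (Localization.Away b)) ⟶ Spec (.of B) :=
    Spec.map (CommRingCat.ofHom (algebraMap B (Localization.Away b)))
  have hl : IsOpenImmersion l := IsOpenImmersion.of_isLocalization (R := CommRingCat.of B) b
  have hrange : Set.range (l ≫ e) ⊆ Set.range V.ι := by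
    rw [Scheme.Opens.range_ι]
    rintro _ ⟨z, rfl⟩
    rw [Scheme.Hom.comp_apply]
    apply hbV
    have := PrimeSpectrum.localization_away_comap_range (Localization.Away b) b
    exact this.le ⟨z, rfl⟩
  let m := IsOpenImmersion.lift V.ι (l ≫ e) hrange
  have hm : m ≫ V.ι = l ≫ e := IsOpenImmersion.lift_fac _ _ _
  have : IsOpenImmersion m := by
    have : IsOpenImmersion (m ≫ V.ι) := by rw [hm]; infer_instance
    exact IsOpenImmersion.of_comp m V.ι
  have h1 : m ≫ V.ι ≫ s =
      Spec.map (CommRingCat.ofHom (algebraMap K (Localization.Away b))) := by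
    rw [← Category.assoc, hm, Category.assoc, hs, ← Spec.map_comp, ← CommRingCat.ofHom_comp,
      ← IsScalarTower.algebraMap_eq]
  have h2 : Smooth (Spec.map (CommRingCat.ofHom (algebraMap K (Localization.Away b)))) := by
    rw [← h1]
    infer_instance
  have h3 : (algebraMap K (Localization.Away b)).Smooth :=
    (HasRingHomProperty.Spec_iff (P := @Smooth)).mp h2
  exact Algebra.basicOpen_subset_smoothLocus_iff_smooth.mpr (RingHom.smooth_algebraMap.mp h3) hcb

end ChartPoints

/-! ### The projection to the plane and its fibres on the chart -/

section PlaneProjection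

open HomogeneousLocalization ProjectiveVariety

variable {K : Type u} [Field K] {N : ℕ} {X : Scheme.{u}} (i : X ⟶ projSpace K N)
  {B : Type u} [CommRing B] [Algebra K B]

/-- The linear projection to the plane given by three linear forms without common zero, together
with its description on the chart where the first form does not vanish. -/
theorem exists_plane_projection [IsClosedImmersion i] {ℓ₀ : MvPolynomial (Fin (N + 1)) K}
    (h₀ : ℓ₀ ∈ grading K N 1) (ψ : Away (grading K N) ℓ₀ →+* B)
    (hψ : ψ.comp (awayScalar K N ℓ₀) = algebraMap K B) (e : Spec (.of B) ⟶ X) [IsOpenImmersion e]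
    (hrange : e.opensRange = i ⁻¹ᵁ Proj.basicOpen (grading K N) ℓ₀)
    (he : e ≫ i = Spec.map (CommRingCat.ofHom ψ) ≫
      Proj.awayι (grading K N) ℓ₀ h₀ one_pos) (ℓ : Fin 3 → grading K N 1) (hℓ : ℓ 0 = ⟨ℓ₀, h₀⟩)
    (hcov : ∀ x : X, ∃ j, i x ∈ Proj.basicOpen (grading K N) (ℓ j : MvPolynomial (Fin (N + 1)) K)) :
    (planeHom K (affineCoord h₀ ψ hψ (ℓ 1)) (affineCoord h₀ ψ hψ (ℓ 2))).IsIntegral ∧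
    ∃ g : X ⟶ projSpace K 2, g ≫ projSpaceStr K 2 = i ≫ projSpaceStr K N ∧ IsFinite g ∧
      g ⁻¹ᵁ Proj.basicOpen (grading K 2) (MvPolynomial.X 0) = e.opensRange ∧
      (∃ θ : Away (grading K 2) (MvPolynomial.X 0) →+* B,
        e ≫ g = Spec.map (CommRingCat.ofHom θ) ≫
          Proj.awayι (grading K 2) (MvPolynomial.X 0) (coordForm_mem K 2 0) one_pos ∧
        θ.comp (planeChart K) =
          planeHom K (affineCoord h₀ ψ hψ (ℓ 1)) (affineCoord h₀ ψ hψ (ℓ 2))) ∧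
      (Function.Injective (planeHom K (affineCoord h₀ ψ hψ (ℓ 1)) (affineCoord h₀ ψ hψ (ℓ 2))) →
        IsLinearProjection i g) := by
  obtain ⟨g, hstr, hfin, hpre, hg⟩ := exists_finite_linearSubst i ℓ hcov
  obtain ⟨θ, hθ, hθχ⟩ := exists_chart_planeHom i (linearSubst ℓ) (linearSubst_C ℓ) ℓ
    (linearSubst_X ℓ) (hg 0) h₀ hℓ ψ hψ e he
  have hpre0 : g ⁻¹ᵁ Proj.basicOpen (grading K 2) (MvPolynomial.X 0) = e.opensRange := by
    rw [hpre 0, hrange, hℓ]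
  have hθint : θ.IsIntegral := by
    refine isIntegral_of_isFinite_chart e _ hθ ?_
    rw [Proj.opensRange_awayι, hpre0]
  refine ⟨?_, g, hstr, hfin, hpre0, ⟨θ, hθ, hθχ⟩, fun hinj => ?_⟩
  · rw [← hθχ]
    exact (RingHom.isIntegral_of_surjective _ planeChart_surjective).trans _ _ hθint
  · refine ⟨linearSubst ℓ, linearSubst_C ℓ, ?_, fun x => ?_, hg⟩
    · have hli := linearIndependent_of_planeHom_injective ℓ h₀ hℓ ψ hψ hinj
      have h1 : (fun j : Fin 3 => linearSubst ℓ (MvPolynomial.X j)) =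
          (grading K N 1).subtype ∘ ℓ := funext (linearSubst_X ℓ)
      change LinearIndependent K fun j : Fin 3 => linearSubst ℓ (MvPolynomial.X j)
      rw [h1]
      exact hli.map' (grading K N 1).subtype (Submodule.ker_subtype _)
    · obtain ⟨j, hj⟩ := hcov x
      exact ⟨j, by rwa [linearSubst_X]⟩

/-- Points of a chart with the same image have the same image in the affine plane. -/
theorem comap_eq_of_apply_eq {g : X ⟶ projSpace K 2} (e : Spec (.of B) ⟶ X)
    {θ : Away (grading K 2) (MvPolynomial.X 0) →+* B}
    (hθ : e ≫ g = Spec.map (CommRingCat.ofHom θ) ≫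
      Proj.awayι (grading K 2) (MvPolynomial.X 0) (coordForm_mem K 2 0) one_pos) {a₁ a₂ : B}
    (hχ : θ.comp (planeChart K) = planeHom K a₁ a₂) {y z : PrimeSpectrum B}
    (h : g (e y) = g (e z)) :
    y.asIdeal.comap (planeHom K a₁ a₂) = z.asIdeal.comap (planeHom K a₁ a₂) := by
  let y' : Spec (.of B) := y
  let z' : Spec (.of B) := z
  replace h : g (e y') = g (e z') := h
  rw [← Scheme.Hom.comp_apply, ← Scheme.Hom.comp_apply, hθ, Scheme.Hom.comp_apply,
    Scheme.Hom.comp_apply] at h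
  have h1 := (Proj.awayι (grading K 2) (MvPolynomial.X 0) (coordForm_mem K 2 0)
    one_pos).isOpenEmbedding.injective h
  have h2 : y.asIdeal.comap θ = z.asIdeal.comap θ :=
    congr(($h1 : PrimeSpectrum (Away (grading K 2) (MvPolynomial.X 0))).asIdeal)
  rw [← hχ, ← Ideal.comap_comap, ← Ideal.comap_comap, h2]

end PlaneProjection

/-! ### Choice of the three linear forms -/

theorem lemma1p2 (K : Type u) [Field K] [CharZero K] (N : ℕ)
    -- the surface `X'`, a closed integral subscheme of `ℙᴺ`
    (X' : Scheme.{u}) [IsIntegral X'] (i : X' ⟶ ProjectiveVariety.projSpace K N)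
    [IsClosedImmersion i] (hdim : topologicalKrullDim X' = 2)
    -- the smooth open subset `X`, with complement `∂X`
    (X : X'.Opens) (hXsmooth : Smooth (X.ι ≫ i ≫ ProjectiveVariety.projSpaceStr K N))
    -- the closed point `P` of `∂X`
    (P : X') (hPclosed : IsClosed {P}) (hPX : P ∉ X)
    -- the curve `C'`, a closed integral subscheme of `X'` through `P`, not contained in `∂X`
    (C' : Scheme.{u}) [IsIntegral C'] (j : C' ⟶ X') [IsClosedImmersion j]
    (hCdim : topologicalKrullDim C' = 1) (hPC : P ∈ Set.range j)
    (hCX : ¬ Set.range j ⊆ (X : Set X')ᶜ) :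
    ∃ g : X' ⟶ ProjectiveVariety.projSpace K 2,
      g ≫ ProjectiveVariety.projSpaceStr K 2 = i ≫ ProjectiveVariety.projSpaceStr K N ∧
      IsFinite g ∧
      ProjectiveVariety.IsLinearProjection i g ∧
      g (j (genericPoint C')) ∉ ProjectiveVariety.branchLocus g ∧
      ∀ W ∈ irreducibleComponents ((X : Set X')ᶜ : Set X'),
        topologicalKrullDim W = 1 →
        P ∉ Subtype.val '' W → g P ∉ g '' (Subtype.val '' W) := by
  have := noetherianSpace_of_isClosedImmersion i
  have hηsp (z : C') : j (genericPoint C') ⤳ j z :=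
    (genericPoint_specializes z).map j.continuous
  have hηX : j (genericPoint C') ∈ X := by
    obtain ⟨_, ⟨z, rfl⟩, hz⟩ := Set.not_subset.mp hCX
    exact (hηsp z).mem_open X.isOpen (by simpa using hz)
  have hηP : j (genericPoint C') ⤳ P := by
    obtain ⟨z, rfl⟩ := hPC
    exact hηsp z
  -- Otherwise the closed immersion of C' would be a homeomorphism onto X', whose dimension is
  -- different.
  have hηne : j (genericPoint C') ≠ genericPoint X' := by
    intro heq
    have hsurj : Function.Surjective j := fun z =>
      (heq ▸ genericPoint_specializes z : j (genericPoint C') ⤳ z).mem_closed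
        j.isClosedEmbedding.isClosed_range ⟨_, rfl⟩
    have hhomeo : IsHomeomorph j :=
      isHomeomorph_iff_isEmbedding_surjective.mpr ⟨j.isClosedEmbedding.isEmbedding, hsurj⟩
    have := hhomeo.topologicalKrullDim_eq
    rw [hdim, hCdim] at this
    exact absurd this (by decide)
  have hW (W : irreducibleComponents ((X : Set X')ᶜ : Set X')) :
      ∃ w : X', IsGenericPoint w (Subtype.val '' (W : Set ((X : Set X')ᶜ : Set X'))) :=
    QuasiSober.sober (W.2.1.image _ continuous_subtype_val.continuousOn)
      (X.isOpen.isClosed_compl.isClosedEmbedding_subtypeVal.isClosedMap _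
        (isClosed_of_mem_irreducibleComponents _ W.2))
  choose w hw using hW
  have hwX (W) : w W ∉ X := by
    obtain ⟨z, -, hz⟩ := (hw W).mem
    exact hz ▸ z.2
  have hfinW : Finite (irreducibleComponents ((X : Set X')ᶜ : Set X')) :=
    TopologicalSpace.NoetherianSpace.finite_irreducibleComponents.to_subtype
  -- Nonvanishing at P also puts the generic points of C' and X' in the chart, since they specialize
  -- to P.
  obtain ⟨⟨ℓ₀, h₀⟩, hPℓ₀, hWℓ₀⟩ := ((generic_mem_basicOpen (i P)).and
    (GenericProp.forall_mem (Set.finite_univ (α := irreducibleComponents ((X : Set X')ᶜ : Set X')))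
      fun W _ => generic_mem_basicOpen (i (w W)))).exists_of_infinite
  obtain ⟨B, _, ψ, e, _, hψs, hrange, he⟩ := exists_affine_chart i h₀
  let : Algebra K B := (ψ.comp (awayScalar K N ℓ₀)).toAlgebra
  have hψ : ψ.comp (awayScalar K N ℓ₀) = algebraMap K B := rfl
  have := finiteType_of_surjective h₀ ψ hψ hψs
  have hlift (x : X') (hx : i x ∈ Proj.basicOpen (ProjectiveVariety.grading K N) ℓ₀) :
      ∃ y : PrimeSpectrum B, e y = x := by
    have : x ∈ e.opensRange := hrange ▸ hx
    exact this
  obtain ⟨p, hp⟩ := hlift P hPℓ₀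
  have : Nonempty (PrimeSpectrum B) := ⟨p⟩
  have := isDomain_chart e
  obtain ⟨c, hc⟩ := hlift (j (genericPoint C')) ((hηP.map i.continuous).mem_open
    (Proj.basicOpen (ProjectiveVariety.grading K N) ℓ₀).isOpen hPℓ₀)
  have hpmax : p.asIdeal.IsMaximal := isMaximal_of_isClosed_chart e p (hp ▸ hPclosed)
  have hcp : c.asIdeal ≤ p.asIdeal := (le_iff_specializes_chart e c p).mpr (hc ▸ hp ▸ hηP)
  have hcmax : ¬ c.asIdeal.IsMaximal := by
    intro hmax
    have : c = p := PrimeSpectrum.ext (hmax.eq_of_le hpmax.ne_top hcp)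
    exact hPX (hp ▸ this ▸ hc ▸ hηX)
  have hbot (y : PrimeSpectrum B) (hy : y.asIdeal = ⊥) : e y = genericPoint X' := by
    obtain ⟨z, hz⟩ := hlift (genericPoint X') (((genericPoint_specializes P).map
      i.continuous).mem_open (Proj.basicOpen (ProjectiveVariety.grading K N) ℓ₀).isOpen hPℓ₀)
    have h1 : e y ⤳ e z := (le_iff_specializes_chart e y z).mp (hy ▸ bot_le)
    exact (h1.antisymm (hz ▸ genericPoint_specializes _)).eq.trans hz
  have hcbot : c.asIdeal ≠ ⊥ := fun h => hηne (hc ▸ hbot c h)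
  let lam := affineCoord h₀ ψ hψ
  have hlam : Algebra.adjoin K (Set.range lam) = ⊤ := adjoin_range_affineCoord h₀ ψ hψ hψs
  have hcover := generic_cover i hdim ⟨ℓ₀, h₀⟩ ⟨P, hPℓ₀⟩
  have hint (ℓ₁ ℓ₂ : ProjectiveVariety.grading K N 1)
      (h : ∀ x : X', ∃ j : Fin 3, i x ∈ Proj.basicOpen (ProjectiveVariety.grading K N)
        (![⟨ℓ₀, h₀⟩, ℓ₁, ℓ₂] j : MvPolynomial (Fin (N + 1)) K)) :
      (planeHom K (lam ℓ₁) (lam ℓ₂)).IsIntegral :=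
    (exists_plane_projection i h₀ ψ hψ e hrange he ![⟨ℓ₀, h₀⟩, ℓ₁, ℓ₂] rfl h).1
  have hstr : e ≫ i ≫ ProjectiveVariety.projSpaceStr K N =
      Spec.map (CommRingCat.ofHom (algebraMap K B)) := by
    rw [reassoc_of% he, awayι_projSpaceStr h₀, ← Spec.map_comp, ← CommRingCat.ofHom_comp, hψ]
  have : Algebra.FormallySmooth K (Localization.AtPrime c.asIdeal) :=
    formallySmooth_chart e X _ hstr hXsmooth c (hc ▸ hηX)
  have hcoord : GenericProp K fun ℓ₁ : ProjectiveVariety.grading K N 1 =>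
      ∃ x₀ : B, ∀ x : B, ∃ s ∉ c.asIdeal, ∃ r₁ r₀ : B,
        s • KaehlerDifferential.D K B x = r₁ • KaehlerDifferential.D K B (lam ℓ₁) +
          r₀ • KaehlerDifferential.D K B x₀ := by
    -- These are auxiliary forms: one integral map to the plane is enough to bound the rank of the
    -- differentials.
    obtain ⟨ℓ₁, h₁⟩ := hcover.exists_of_infinite
    obtain ⟨ℓ₂, h₂⟩ := h₁.exists_of_infinite
    exact generic_exists_coordinates lam hlam (hint ℓ₁ ℓ₂ h₂) c.asIdeal
  have hsep (W : irreducibleComponents ((X : Set X')ᶜ : Set X')) (hPW : P ∉ Subtype.val '' (W : Set ((X : Set X')ᶜ : Set X'))) :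
      GenericProp K fun ℓ₁ : ProjectiveVariety.grading K N 1 => GenericProp K fun ℓ₂ =>
        ∀ x ∈ Subtype.val '' (W : Set ((X : Set X')ᶜ : Set X')), ∀ y : PrimeSpectrum B, e y = x →
          y.asIdeal.comap (planeHom K (lam ℓ₁) (lam ℓ₂)) ≠
            p.asIdeal.comap (planeHom K (lam ℓ₁) (lam ℓ₂)) := by
    obtain ⟨q, hq⟩ := hlift (w W) (hWℓ₀ W trivial)
    have hqbot : q.asIdeal ≠ ⊥ := by
      intro h
      apply hwX W
      rw [← hq, hbot q h]
      exact (genericPoint_specializes _).mem_open X.isOpen hηX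
    have hqp : ¬ q.asIdeal ≤ p.asIdeal := by
      rw [le_iff_specializes_chart e, hq, hp]
      exact fun h => hPW ((hw W).le (specializes_iff_mem_closure.mp h))
    refine (generic_separates_curve lam hlam (not_chain_chart e hdim) p.asIdeal q.asIdeal
      hqbot hqp).mono fun ℓ₁ h₁ => h₁.mono fun ℓ₂ h₂ x hx y hy => h₂ y.asIdeal y.2 ?_
    rw [le_iff_specializes_chart e, hq, hy]
    exact (hw W).specializes hx
  have hfinW' : {W : irreducibleComponents ((X : Set X')ᶜ : Set X') |
      P ∉ Subtype.val '' (W : Set ((X : Set X')ᶜ : Set X'))}.Finite := Set.toFinite _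
  obtain ⟨ℓ₁, ⟨⟨hcov₁, htr₁⟩, hcoord₁⟩, hsep₁⟩ := (((hcover.and
    (generic_transcendental lam hlam c.asIdeal hcmax)).and hcoord).and
    (GenericProp.forall_mem hfinW' fun W hPW => hsep W hPW)).exists_of_infinite
  -- With ℓ₁ fixed, the remaining conditions on ℓ₂ are generic and are carried through the pencil
  -- argument.
  obtain ⟨ℓ₂, ⟨hcov₂, hsep₂⟩, hinj, het⟩ := exists_etale_projection lam hlam
    (hcov₁.and (GenericProp.forall_mem hfinW' hsep₁)) (fun ℓ₂ h => hint ℓ₁ ℓ₂ h.1) c.asIdeal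
    hcbot htr₁ hcoord₁
  obtain ⟨-, g, hg, hgfin, hgpre, ⟨θ, hθ, hθχ⟩, hlin⟩ := exists_plane_projection i h₀ ψ hψ e
    hrange he ![⟨ℓ₀, h₀⟩, ℓ₁, ℓ₂] rfl hcov₂
  -- The chart is the full preimage of a chart of the plane, so a fibre of g meeting it lies inside
  -- it; both remaining claims can then be checked on B.
  have hliftg (x : X') (y : PrimeSpectrum B) (hxy : g x = g (e y)) : ∃ z : PrimeSpectrum B, e z = x := by
    have h1 : e y ∈ g ⁻¹ᵁ Proj.basicOpen (ProjectiveVariety.grading K 2) (MvPolynomial.X 0) :=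
      hgpre ▸ ⟨y, rfl⟩
    have h2 : x ∈ e.opensRange := by
      rw [← hgpre]
      change g x ∈ Proj.basicOpen (ProjectiveVariety.grading K 2) (MvPolynomial.X 0)
      rw [hxy]
      exact h1
    exact h2
  refine ⟨g, hg, hgfin, hlin hinj, ?_, fun W hWc _ hPW => ?_⟩
  · rintro ⟨x, hx, hxη⟩
    rw [← hc] at hxη
    obtain ⟨y, rfl⟩ := hliftg x c hxη
    obtain ⟨f, hf, hfet⟩ := het y (comap_eq_of_apply_eq e hθ hθχ hxη)
    exact hx (isEtaleAt_of_chart e _ hθ y hf (etale_of_planeHom _ hθχ hinj hfet))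
  · rintro ⟨x, hx, hxP⟩
    rw [← hp] at hxP
    obtain ⟨y, rfl⟩ := hliftg x p hxP
    exact hsep₂ ⟨W, hWc⟩ hPW _ hx y rfl (comap_eq_of_apply_eq e hθ hθχ hxP)
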